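/- For positive integers $n\ge 2k$, let $\operatorname{SG}(n,k)$ denote the Schrijver graph: its vertices are the $k$-element subsets $S$ of $[n]=\{1,\dots,n\}$ that are $2$-stable, i.e. $2\le |i-j|\le n-2$ for all distinct $i,j\in S$, and two vertices are adjacent if and only if they are disjoint. Let $D(G)$ denote the diameter of a connected graph $G$, i.e. the maximum over all pairs of vertices of the length of a shortest path joining them. **Theorem.** Let $n,k,m$ be integers with $n=3k-2-m$ and $1\le m\le k-4$. Then $\operatorname{SG}(n,k)$ is connected and $$D(\operatorname{SG}(n,k))\le m+3 .$$ Equivalently, for all integers $k,r$ with $2\le r\le k-3$, the graph $\operatorname{SG}(2k+r,k)$ is connected and $$D(\operatorname{SG}(2k+r,k))\le k-r+1 .$$ -/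

import Mathlib

/-- A vertex of the Kneser graph `KG(n, k)`: a `k`-element subset of `[n] = {1, …, n}`. -/
abbrev KneserVertex (n k : ℕ) : Type :=
  {A : Finset ℕ // A ⊆ Finset.Icc 1 n ∧ A.card = k}

/-- The Kneser graph `KG(n, k)`: distinct `k`-subsets of `[n]` are adjacent when they are disjoint.
(Distinctness is automatic for `k ≥ 1`.) -/
def kneserGraph (n k : ℕ) : SimpleGraph (KneserVertex n k) where
  Adj A B := A ≠ B ∧ Disjoint A.1 B.1
  symm := ⟨fun _ _ h => ⟨h.1.symm, h.2.symm⟩⟩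
  loopless := ⟨fun _ h => h.1 rfl⟩

/-- `S ⊆ [n]` is `s`-stable: `s ≤ |i - j| ≤ n - s` for all distinct `i, j ∈ S`. -/
def IsStable (s n : ℕ) (S : Finset ℕ) : Prop :=
  ∀ i ∈ S, ∀ j ∈ S, i ≠ j →
    (s : ℤ) ≤ |(i : ℤ) - (j : ℤ)| ∧ |(i : ℤ) - (j : ℤ)| ≤ (n : ℤ) - (s : ℤ)

/-- The vertices of the Kneser graph that are `s`-stable sets. -/
def stableVertices (s n k : ℕ) : Set (KneserVertex n k) :=
  {A | IsStable s n A.1}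

/-- The `s`-stable Kneser graph: the subgraph of `KG(n, k)` induced on the `s`-stable
`k`-subsets of `[n]`. -/
def stableKneserGraph (s n k : ℕ) : SimpleGraph (stableVertices s n k) :=
  (kneserGraph n k).induce (stableVertices s n k)

/-- The Schrijver graph `SG(n, k)`, i.e. the `2`-stable Kneser graph. -/
def schrijverGraph (n k : ℕ) : SimpleGraph (stableVertices 2 n k) :=
  stableKneserGraph 2 n k

/-! Write n = 2k + r and k = r + m with m ≥ 3, and regard a stable set as an n-periodic set of
integers without neighbours. Any two such sets are joined by a walk of length exactly m or m + 1;
this is `hasStableWalk`, proved by induction on r. Keeping two exact lengths, rather than an upper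
bound, lets every reduction preserve the length.

The reduction deletes three consecutive positions containing one element of each set. Then (n, k, r)
becomes (n - 3, k - 1, r - 1) while m stays fixed. A walk of length at least 3 between the shortened
sets lifts: each intermediate set needs an element put back into the three positions, distinct for
consecutive sets, and this is a list colouring of a path with prescribed ends. The window is centred
at an element x of B beside a gap of length at least 3. If A contains both x - 1 and x + 1, it has
one element too many there, and the surplus one is moved to a free position of A.

If A has a free position and no reduction applies, gap ends of B are tightly constrained relative to
A (`gapEnd_cases`). If B has a free position as well, then A + 1 misses B, giving the walk A, A + 1,
B; if B has none, an injection from A into B that is not onto contradicts the equal sizes.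

If neither set has a free position, all gaps have length 2 or 3, exactly r of them of length 3.
Moving each long gap by one position in either direction gives a disjoint set, so the long gaps of A
can walk independently to those of B. A cyclic matching of the long gaps with all displacements at
most m + 1 exists because n = 3r + 2m. -/

/-! ### Periodic sets of integers and their counts per period -/

/-- A set of integers invariant under translation by `n`. -/
def IsPeriodicSet (n : ℕ) (S : Set ℤ) : Prop :=
  ∀ x : ℤ, x + n ∈ S ↔ x ∈ S

/-- The number of elements of `S` in the window `1, …, n`. -/
noncomputable def windowCount (n : ℕ) (S : Set ℤ) : ℕ :=
  open Classical in ((Finset.Ioc (0 : ℤ) n).filter (· ∈ S)).card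

/-- An `n`-periodic set of integers without two consecutive elements and with `k` elements per
period: a `2`-stable `k`-subset of the `n`-cycle. -/
structure IsCyclicStable (n k : ℕ) (S : Set ℤ) : Prop where
  periodic : IsPeriodicSet n S
  succ_notMem : ∀ x ∈ S, x + 1 ∉ S
  count : windowCount n S = k

/-- The translate of a set of integers. -/
def shiftSet (t : ℤ) (S : Set ℤ) : Set ℤ := {x | x + t ∈ S}

@[simp] lemma mem_shiftSet {t x : ℤ} {S : Set ℤ} : x ∈ shiftSet t S ↔ x + t ∈ S := Iff.rfl

lemma IsPeriodicSet.add_mul {n : ℕ} {S : Set ℤ} (h : IsPeriodicSet n S) (x q : ℤ) :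
    x + n * q ∈ S ↔ x ∈ S := by
  induction q using Int.induction_on with
  | zero => simp
  | succ i ih => rw [← ih, ← h (x + n * i)]; ring_nf
  | pred i ih => rw [← ih, ← h (x + n * (-i - 1))]; ring_nf

lemma IsPeriodicSet.shift {n : ℕ} {S : Set ℤ} (h : IsPeriodicSet n S) (t : ℤ) :
    IsPeriodicSet n (shiftSet t S) := by
  intro x
  simp only [mem_shiftSet]
  rw [← h (x + t)]
  ring_nf

lemma exists_mul_add_mem_window {n : ℕ} (hn : 0 < n) (x : ℤ) :
    ∃ q : ℤ, 0 < x + n * q ∧ x + n * q ≤ n := by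
  refine ⟨-((x - 1) / n), ?_⟩
  have h1 := Int.emod_add_mul_ediv (x - 1) n
  have h2 := Int.emod_nonneg (x - 1) (b := n) (by omega)
  have h3 := Int.emod_lt_of_pos (x - 1) (b := n) (by omega)
  have h4 : x + n * -((x - 1) / n) = (x - 1) % n + 1 := by linarith
  omega

lemma IsPeriodicSet.subset_of_window {n : ℕ} {S T : Set ℤ} (hn : 0 < n) (hS : IsPeriodicSet n S)
    (hT : IsPeriodicSet n T) (h : ∀ x : ℤ, 0 < x → x ≤ n → x ∈ S → x ∈ T) : S ⊆ T := by
  intro x hx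
  obtain ⟨q, h0, h1⟩ := exists_mul_add_mem_window hn x
  rw [← hT.add_mul x q]
  exact h _ h0 h1 ((hS.add_mul x q).2 hx)

lemma IsPeriodicSet.ext_window {n : ℕ} {S T : Set ℤ} (hn : 0 < n) (hS : IsPeriodicSet n S)
    (hT : IsPeriodicSet n T) (h : ∀ x : ℤ, 0 < x → x ≤ n → (x ∈ S ↔ x ∈ T)) : S = T :=
  Set.Subset.antisymm (hS.subset_of_window hn hT fun x h0 h1 => (h x h0 h1).1)
    (hT.subset_of_window hn hS fun x h0 h1 => (h x h0 h1).2)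

lemma windowCount_shift_one {n : ℕ} {S : Set ℤ} (h : IsPeriodicSet n S) :
    windowCount n (shiftSet 1 S) = windowCount n S := by
  classical
  rcases Nat.eq_zero_or_pos n with rfl | hn
  · simp [windowCount]
  unfold windowCount
  refine Finset.card_bij' (fun x _ => if x = (n : ℤ) then 1 else x + 1)
    (fun x _ => if x = 1 then (n : ℤ) else x - 1) ?_ ?_ ?_ ?_
  · intro x hx
    simp only [Finset.mem_filter, Finset.mem_Ioc, mem_shiftSet] at hx ⊢
    split_ifs with hxn
    · subst hxn
      refine ⟨by omega, ?_⟩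
      rw [← h 1, add_comm]
      exact hx.2
    · exact ⟨by omega, hx.2⟩
  · intro x hx
    simp only [Finset.mem_filter, Finset.mem_Ioc, mem_shiftSet] at hx ⊢
    split_ifs with hx1
    · subst hx1
      refine ⟨by omega, ?_⟩
      rw [add_comm, h 1]
      exact hx.2
    · refine ⟨by omega, ?_⟩
      simpa using hx.2
  · intro x hx
    simp only [Finset.mem_filter, Finset.mem_Ioc, mem_shiftSet] at hx
    split_ifs <;> omega
  · intro x hx
    simp only [Finset.mem_filter, Finset.mem_Ioc] at hx
    split_ifs <;> omega

lemma windowCount_shift {n : ℕ} {S : Set ℤ} (h : IsPeriodicSet n S) (t : ℤ) :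
    windowCount n (shiftSet t S) = windowCount n S := by
  have key : ∀ s : ℤ, shiftSet (s + 1) S = shiftSet 1 (shiftSet s S) := by
    intro s; ext x; simp only [mem_shiftSet]; ring_nf
  induction t using Int.induction_on with
  | zero => congr 1; ext x; simp
  | succ i ih => rw [key, windowCount_shift_one (h.shift _), ih]
  | pred i ih =>
    rw [← windowCount_shift_one (h.shift _), ← key, sub_add_cancel, ih]

lemma windowCount_univ (n : ℕ) : windowCount n Set.univ = n := by
  simp [windowCount]

lemma windowCount_union {n : ℕ} {S T : Set ℤ} (h : Disjoint S T) :
    windowCount n (S ∪ T) = windowCount n S + windowCount n T := by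
  classical
  unfold windowCount
  rw [← Finset.card_union_of_disjoint]
  · congr 1
    ext x
    simp only [Finset.mem_filter, Finset.mem_union, Set.mem_union]
    tauto
  · rw [Finset.disjoint_filter]
    intro x _ hx hx'
    exact Set.disjoint_left.1 h hx hx'

lemma windowCount_lt {n : ℕ} {S T : Set ℤ} (hn : 0 < n) (hS : IsPeriodicSet n S)
    (hT : IsPeriodicSet n T) (h : S ⊆ T) {x : ℤ} (hx : x ∈ T) (hx' : x ∉ S) :
    windowCount n S < windowCount n T := by
  classical
  obtain ⟨q, h0, h1⟩ := exists_mul_add_mem_window hn x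
  refine Finset.card_lt_card (Finset.ssubset_iff_of_subset
    (Finset.monotone_filter_right _ fun x _ hx => h hx) |>.2 ⟨x + n * q, ?_, ?_⟩)
  · simp only [Finset.mem_filter, Finset.mem_Ioc]
    exact ⟨⟨h0, h1⟩, (hT.add_mul x q).2 hx⟩
  · simp only [Finset.mem_filter, not_and]
    exact fun _ hm => hx' ((hS.add_mul x q).1 hm)

lemma IsCyclicStable.shift {n k : ℕ} {S : Set ℤ} (h : IsCyclicStable n k S) (t : ℤ) :
    IsCyclicStable n k (shiftSet t S) where
  periodic := h.periodic.shift t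
  succ_notMem x hx := by
    have := h.succ_notMem _ hx
    rw [mem_shiftSet]
    rwa [add_right_comm] at this
  count := by rw [windowCount_shift h.periodic, h.count]

lemma IsCyclicStable.disjoint_shift_one {n k : ℕ} {S : Set ℤ} (h : IsCyclicStable n k S) :
    Disjoint S (shiftSet 1 S) :=
  Set.disjoint_left.2 fun x hx hx' => h.succ_notMem x hx hx'

/-! ### Walks of exact length between stable sets -/

/-- `d` successive steps between disjoint cyclically stable sets lead from `A` to `B`. -/
def StableWalk (n k : ℕ) : ℕ → Set ℤ → Set ℤ → Prop
  | 0, A, B => A = B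
  | d + 1, A, B => ∃ C, IsCyclicStable n k C ∧ Disjoint A C ∧ StableWalk n k d C B

lemma StableWalk.snoc {n k d : ℕ} {A B C : Set ℤ} (h : StableWalk n k d A B)
    (hC : IsCyclicStable n k C) (hBC : Disjoint B C) : StableWalk n k (d + 1) A C := by
  induction d generalizing A with
  | zero => cases h; exact ⟨C, hC, hBC, rfl⟩
  | succ d ih =>
    obtain ⟨D, hD, hAD, hDB⟩ := h
    exact ⟨D, hD, hAD, ih hDB⟩

lemma StableWalk.symm {n k d : ℕ} {A B : Set ℤ} (h : StableWalk n k d A B)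
    (hA : IsCyclicStable n k A) : StableWalk n k d B A := by
  induction d generalizing A with
  | zero => exact Eq.symm h
  | succ d ih =>
    obtain ⟨D, hD, hAD, hDB⟩ := h
    exact (ih hDB hD).snoc hA hAD.symm

lemma StableWalk.shift {n k d : ℕ} {A B : Set ℤ} (h : StableWalk n k d A B) (t : ℤ) :
    StableWalk n k d (shiftSet t A) (shiftSet t B) := by
  induction d generalizing A with
  | zero => cases h; rfl
  | succ d ih =>
    obtain ⟨D, hD, hAD, hDB⟩ := h
    exact ⟨shiftSet t D, hD.shift t, hAD.preimage _, ih hDB⟩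

lemma shiftSet_shiftSet (s t : ℤ) (S : Set ℤ) : shiftSet s (shiftSet t S) = shiftSet (s + t) S := by
  ext x; simp only [mem_shiftSet, add_assoc]

lemma shiftSet_zero (S : Set ℤ) : shiftSet 0 S = S := by
  ext x; simp

lemma StableWalk.of_shift {n k d : ℕ} {A B : Set ℤ} (t : ℤ)
    (h : StableWalk n k d (shiftSet t A) (shiftSet t B)) : StableWalk n k d A B := by
  simpa [shiftSet_shiftSet, shiftSet_zero] using h.shift (-t)

/-- A detour to a translate of A by one position and back costs two steps, so only the parity of a
length is rigid. -/
lemma StableWalk.add_two {n k d : ℕ} {A B : Set ℤ} (hA : IsCyclicStable n k A)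
    (h : StableWalk n k d A B) : StableWalk n k (d + 2) A B :=
  ⟨_, hA.shift 1, hA.disjoint_shift_one, A, hA, hA.disjoint_shift_one.symm, h⟩

lemma StableWalk.add_two_mul {n k d : ℕ} {A B : Set ℤ} (hA : IsCyclicStable n k A)
    (h : StableWalk n k d A B) (i : ℕ) : StableWalk n k (d + 2 * i) A B := by
  induction i with
  | zero => exact h
  | succ i ih => exact ih.add_two hA

lemma StableWalk.exists_eq_or_eq_succ {n k d m : ℕ} {A B : Set ℤ} (hA : IsCyclicStable n k A)
    (h : StableWalk n k d A B) (hd : d ≤ m + 1) :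
    StableWalk n k m A B ∨ StableWalk n k (m + 1) A B := by
  rcases Nat.even_or_odd' (m + 1 - d) with ⟨i, hi | hi⟩
  · right
    have := h.add_two_mul hA i
    rwa [show d + 2 * i = m + 1 by omega] at this
  · left
    have := h.add_two_mul hA i
    rwa [show d + 2 * i = m by omega] at this

/-! ### Inserting three positions and lifting walks -/

/-- The `n`-periodic set whose elements in the window `1, …, n` are those satisfying `P`. -/
def periodize (n : ℕ) (P : ℤ → Prop) : Set ℤ := {x | P ((x - 1) % n + 1)}

lemma mem_periodize {n : ℕ} {P : ℤ → Prop} {x : ℤ} (h0 : 0 < x) (h1 : x ≤ n) :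
    x ∈ periodize n P ↔ P x := by
  simp only [periodize, Set.mem_ofPred_eq]
  rw [Int.emod_eq_of_lt (by omega) (by omega), sub_add_cancel]

lemma isPeriodicSet_periodize (n : ℕ) (P : ℤ → Prop) : IsPeriodicSet n (periodize n P) := by
  intro x
  simp only [periodize, Set.mem_ofPred_eq]
  rw [show x + n - 1 = x - 1 + n by ring, Int.add_emod_right]

lemma succ_notMem_of_window {n : ℕ} {S : Set ℤ} (hn : 0 < n) (hS : IsPeriodicSet n S)
    (h : ∀ x : ℤ, 0 < x → x < n → x ∈ S → x + 1 ∉ S) (h1 : (n : ℤ) ∈ S → (1 : ℤ) ∉ S) :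
    ∀ x ∈ S, x + 1 ∉ S := by
  intro x hx hx1
  obtain ⟨q, hq0, hq1⟩ := exists_mul_add_mem_window hn x
  rw [← hS.add_mul x q] at hx
  rw [← hS.add_mul _ q, add_right_comm] at hx1
  rcases hq1.lt_or_eq with hlt | heq
  · exact h _ hq0 hlt hx hx1
  · rw [heq] at hx hx1
    rw [add_comm, hS 1] at hx1
    exact h1 hx hx1

lemma disjoint_of_window {n : ℕ} {S T : Set ℤ} (hn : 0 < n) (hS : IsPeriodicSet n S)
    (hT : IsPeriodicSet n T) (h : ∀ x : ℤ, 0 < x → x ≤ n → x ∈ S → x ∉ T) : Disjoint S T := by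
  refine Set.disjoint_left.2 fun x hx hx' => ?_
  obtain ⟨q, h0, h1⟩ := exists_mul_add_mem_window hn x
  exact h _ h0 h1 ((hS.add_mul x q).2 hx) ((hT.add_mul x q).2 hx')

/-- Enlarge the period of `T` from `n` to `n + 3` by three positions after `n`, and occupy the
position `c` among them. -/
def insertWindow (n : ℕ) (T : Set ℤ) (c : ℤ) : Set ℤ :=
  periodize (n + 3) fun x => (x ≤ n ∧ x ∈ T) ∨ x = c

/-- The position `c ∈ {n + 1, n + 2, n + 3}` can be added to `T` without creating neighbours. -/
structure IsInsertable (n : ℕ) (T : Set ℤ) (c : ℤ) : Prop where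
  lt : n < c
  le : c ≤ n + 3
  left : c = n + 1 → (n : ℤ) ∉ T
  right : c = n + 3 → (1 : ℤ) ∉ T

lemma isInsertable_middle (n : ℕ) (T : Set ℤ) : IsInsertable n T (n + 2) :=
  ⟨by omega, by omega, by omega, by omega⟩

lemma mem_insertWindow {n : ℕ} {T : Set ℤ} {c x : ℤ} (h0 : 0 < x) (h1 : x ≤ n + 3) :
    x ∈ insertWindow n T c ↔ (x ≤ n ∧ x ∈ T) ∨ x = c :=
  mem_periodize h0 (by push_cast; exact h1)

lemma IsCyclicStable.insertWindow {n k : ℕ} {T : Set ℤ} {c : ℤ} (hn : 0 < n)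
    (hT : IsCyclicStable n k T) (hc : IsInsertable n T c) :
    IsCyclicStable (n + 3) (k + 1) (insertWindow n T c) where
  periodic := isPeriodicSet_periodize _ _
  succ_notMem := by
    obtain ⟨h1, h2, h3, h4⟩ := hc
    refine succ_notMem_of_window (by omega) (isPeriodicSet_periodize _ _) ?_ ?_
    · intro x hx0 hx1 hx hx'
      push_cast at hx1
      rw [mem_insertWindow (by omega) (by omega)] at hx hx'
      rcases hx with ⟨hx, hxT⟩ | rfl
      · rcases hx' with ⟨hx', hxT'⟩ | hx'
        · exact hT.succ_notMem _ hxT hxT'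
        · exact h3 (by omega) (by rwa [show (n : ℤ) = x by omega])
      · omega
    · intro hx hx'
      push_cast at hx
      rw [mem_insertWindow (by omega) (by omega)] at hx hx'
      rcases hx with ⟨hx, -⟩ | hx
      · omega
      · rcases hx' with ⟨-, hx'⟩ | hx'
        · exact h4 hx.symm hx'
        · omega
  count := by
    classical
    obtain ⟨h1, h2, h3, h4⟩ := hc
    have := hT.count
    unfold windowCount at this ⊢
    rw [← this, ← Finset.card_insert_of_notMem (a := c)]
    · congr 1
      ext x
      simp only [Finset.mem_filter, Finset.mem_Ioc, Finset.mem_insert]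
      push_cast
      constructor
      · rintro ⟨⟨hx0, hx1⟩, hx⟩
        rw [mem_insertWindow hx0 hx1] at hx
        tauto
      · rintro (rfl | ⟨⟨hx0, hx1⟩, hx⟩)
        · exact ⟨by omega, (mem_insertWindow (by omega) (by omega)).2 (Or.inr rfl)⟩
        · exact ⟨by omega, (mem_insertWindow (by omega) (by omega)).2 (Or.inl ⟨hx1, hx⟩)⟩
    · simp only [Finset.mem_filter, Finset.mem_Ioc]
      omega

lemma disjoint_insertWindow {n : ℕ} {T U : Set ℤ} {c e : ℤ} (h : Disjoint T U)
    (hc : IsInsertable n T c) (he : IsInsertable n U e) (hce : c ≠ e) :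
    Disjoint (insertWindow n T c) (insertWindow n U e) := by
  refine disjoint_of_window (by omega) (isPeriodicSet_periodize _ _)
    (isPeriodicSet_periodize _ _) fun x h0 h1 hx hx' => ?_
  push_cast at h1
  rw [mem_insertWindow h0 h1] at hx hx'
  have := hc.lt
  have := he.lt
  rcases hx with ⟨hx, hxT⟩ | rfl
  · rcases hx' with ⟨-, hxU⟩ | rfl
    · exact Set.disjoint_left.1 h hxT hxU
    · omega
  · rcases hx' with ⟨hx, -⟩ | rfl
    · omega
    · exact hce rfl

lemma IsCyclicStable.one_notMem {n k : ℕ} {T : Set ℤ} (hT : IsCyclicStable n k T)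
    (h : (n : ℤ) ∈ T) : (1 : ℤ) ∉ T := by
  have := hT.succ_notMem _ h
  rwa [add_comm, hT.periodic 1] at this

/-- The middle position is always available, and so is an outer one, since n and 1 are cyclic
neighbours and cannot both lie in T. -/
lemma exists_isInsertable_ne {n k : ℕ} {T : Set ℤ} (hT : IsCyclicStable n k T) (c : ℤ) :
    ∃ e, IsInsertable n T e ∧ e ≠ c := by
  by_cases hc : c = n + 2
  · by_cases h : (n : ℤ) ∈ T
    · exact ⟨n + 3, ⟨by omega, by omega, by omega, fun _ => hT.one_notMem h⟩, by omega⟩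
    · exact ⟨n + 1, ⟨by omega, by omega, fun _ => h, by omega⟩, by omega⟩
  · exact ⟨n + 2, isInsertable_middle n T, Ne.symm hc⟩

/-- The end of the list colouring: two consecutive sets remain, between the colour c and the final
colour n + 2. If an outer position is blocked for T by n or 1, disjointness makes it available for
U, and it never conflicts with T. Otherwise all three positions are open to T. -/
lemma exists_isInsertable_pair {n k : ℕ} {T U : Set ℤ} (hT : IsCyclicStable n k T)
    (hU : IsCyclicStable n k U) (h : Disjoint T U) (c : ℤ) :
    ∃ e f, IsInsertable n T e ∧ IsInsertable n U f ∧ c ≠ e ∧ e ≠ f ∧ f ≠ n + 2 := by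
  have hd := Set.disjoint_left.1 h
  by_cases hnT : (n : ℤ) ∈ T
  · have hf : IsInsertable n U (n + 1) := ⟨by omega, by omega, fun _ => hd hnT, by omega⟩
    by_cases hc : c = n + 2
    · exact ⟨n + 3, n + 1, ⟨by omega, by omega, by omega, fun _ => hT.one_notMem hnT⟩, hf,
        by omega, by omega, by omega⟩
    · exact ⟨n + 2, n + 1, isInsertable_middle n T, hf, by omega, by omega, by omega⟩
  by_cases h1T : (1 : ℤ) ∈ T
  · have hf : IsInsertable n U (n + 3) := ⟨by omega, by omega, by omega, fun _ => hd h1T⟩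
    by_cases hc : c = n + 2
    · exact ⟨n + 1, n + 3, ⟨by omega, by omega, fun _ => hnT, by omega⟩, hf,
        by omega, by omega, by omega⟩
    · exact ⟨n + 2, n + 3, isInsertable_middle n T, hf, by omega, by omega, by omega⟩
  obtain ⟨f, hf, hf2⟩ := exists_isInsertable_ne hU (n + 2)
  have hT' : ∀ e : ℤ, n < e → e ≤ n + 3 → IsInsertable n T e :=
    fun e h1 h2 => ⟨h1, h2, fun _ => hnT, fun _ => h1T⟩
  have h1 := hf.lt
  have h2 := hf.le
  by_cases hc : c = n + 2
  -- The mirror image of f in the middle position n + 2.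
  · exact ⟨2 * n + 4 - f, f, hT' _ (by omega) (by omega), hf, by omega, by omega, hf2⟩
  · exact ⟨n + 2, f, hT' _ (by omega) (by omega), hf, hc, by omega, hf2⟩

lemma StableWalk.insertWindow_middle {n k : ℕ} {T U : Set ℤ} (hn : 0 < n)
    (h : StableWalk n k 2 T U) :
    StableWalk (n + 3) (k + 1) 2 (insertWindow n T (n + 2)) (insertWindow n U (n + 2)) := by
  obtain ⟨C, hC, hTC, _, hU, hCU, rfl⟩ := h
  obtain ⟨e, he, hne⟩ := exists_isInsertable_ne hC (n + 2)
  exact ⟨_, hC.insertWindow hn he, disjoint_insertWindow hTC (isInsertable_middle _ _) he hne.symm,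
    _, hU.insertWindow hn (isInsertable_middle _ _),
    disjoint_insertWindow hCU he (isInsertable_middle _ _) hne, rfl⟩

/-- Colours are chosen greedily until two intermediate sets remain. With a single intermediate set
and different end colours, its two available positions could both be forbidden; hence 3 ≤ d. -/
lemma StableWalk.insertWindow {n k d : ℕ} {T U : Set ℤ} {c : ℤ} (hn : 0 < n) (hd : 3 ≤ d)
    (h : StableWalk n k d T U) (hc : IsInsertable n T c) :
    StableWalk (n + 3) (k + 1) d (insertWindow n T c) (insertWindow n U (n + 2)) := by
  induction d, hd using Nat.le_induction generalizing T c with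
  | base =>
    obtain ⟨C, hC, hTC, D, hD, hCD, _, hU, hDU, rfl⟩ := h
    obtain ⟨e, f, he, hf, h1, h2, h3⟩ := exists_isInsertable_pair hC hD hCD c
    exact ⟨_, hC.insertWindow hn he, disjoint_insertWindow hTC hc he h1,
      _, hD.insertWindow hn hf, disjoint_insertWindow hCD he hf h2,
      _, hU.insertWindow hn (isInsertable_middle _ _),
      disjoint_insertWindow hDU hf (isInsertable_middle _ _) h3, rfl⟩
  | succ d hd ih =>
    obtain ⟨C, hC, hTC, hCU⟩ := h
    obtain ⟨e, he, hne⟩ := exists_isInsertable_ne hC c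
    exact ⟨_, hC.insertWindow hn he, disjoint_insertWindow hTC hc he hne.symm, ih hCU he⟩

/-! ### Deleting three positions -/

lemma isCyclicStable_contract {n k : ℕ} {S : Set ℤ} (hn : 0 < n)
    (hS : IsCyclicStable (n + 3) (k + 1) S) {c : ℤ} (h1 : n < c) (h2 : c ≤ n + 3)
    (hc : ∀ x : ℤ, n < x → x ≤ n + 3 → (x ∈ S ↔ x = c)) (h : (n : ℤ) ∈ S → (1 : ℤ) ∉ S) :
    IsCyclicStable n k (periodize n (· ∈ S)) where
  periodic := isPeriodicSet_periodize _ _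
  succ_notMem := by
    refine succ_notMem_of_window hn (isPeriodicSet_periodize _ _) ?_ ?_
    · intro x hx0 hx1 hx
      rw [mem_periodize (by omega) (by omega)] at hx ⊢
      exact hS.succ_notMem x hx
    · intro hx
      rw [mem_periodize (by omega) (by omega)] at hx ⊢
      exact h hx
  count := by
    classical
    have := hS.count
    unfold windowCount at this ⊢
    apply Nat.succ_injective
    rw [Nat.succ_eq_add_one, Nat.succ_eq_add_one, ← this, ← Finset.card_insert_of_notMem (a := c)]
    · congr 1
      ext x
      simp only [Finset.mem_filter, Finset.mem_Ioc, Finset.mem_insert]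
      push_cast
      constructor
      · rintro (rfl | ⟨⟨hx0, hx1⟩, hx⟩)
        · exact ⟨by omega, (hc _ h1 h2).2 rfl⟩
        · exact ⟨by omega, (mem_periodize hx0 hx1).1 hx⟩
      · rintro ⟨⟨hx0, hx1⟩, hx⟩
        by_cases hxn : x ≤ n
        · exact Or.inr ⟨by omega, (mem_periodize hx0 hxn).2 hx⟩
        · exact Or.inl ((hc x (by omega) hx1).1 hx)
    · simp only [Finset.mem_filter, Finset.mem_Ioc]
      omega

lemma insertWindow_contract {n : ℕ} {S : Set ℤ} {c : ℤ} (hS : IsPeriodicSet (n + 3) S)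
    (hc : ∀ x : ℤ, n < x → x ≤ n + 3 → (x ∈ S ↔ x = c)) (h1 : n < c) :
    insertWindow n (periodize n (· ∈ S)) c = S := by
  refine IsPeriodicSet.ext_window (by omega) (isPeriodicSet_periodize _ _) hS fun x h0 h3 => ?_
  push_cast at h3
  rw [mem_insertWindow h0 h3]
  by_cases hx : x ≤ n
  · rw [mem_periodize h0 hx]
    constructor
    · rintro (⟨-, h⟩ | h)
      · exact h
      · omega
    · exact fun h => Or.inl ⟨hx, h⟩
  · rw [hc x (by omega) h3]
    constructor
    · rintro (⟨h, -⟩ | h)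
      · omega
      · exact h
    · exact Or.inr

lemma isInsertable_contract {n k : ℕ} {S : Set ℤ} {c : ℤ} (hn : 0 < n)
    (hS : IsCyclicStable (n + 3) k S) (hc : c ∈ S) (h1 : n < c) (h2 : c ≤ n + 3) :
    IsInsertable n (periodize n (· ∈ S)) c := by
  refine ⟨h1, h2, fun h hx => ?_, fun h hx => ?_⟩
  · rw [mem_periodize (by omega) (by omega)] at hx
    exact hS.succ_notMem _ hx (h ▸ hc)
  · rw [mem_periodize (by omega) (by omega)] at hx
    refine hS.one_notMem ?_ hx
    push_cast
    exact h ▸ hc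

/-- If, in two sets, three consecutive positions contain exactly one element each, the middle one
in the second set, then a walk between the sets without these positions extends to a walk of the
same length. -/
lemma stableWalk_of_contract {n k d : ℕ} {A B : Set ℤ} {c : ℤ} (hn : 0 < n) (hd : 3 ≤ d)
    (hA : IsCyclicStable (n + 3) (k + 1) A) (hB : IsCyclicStable (n + 3) (k + 1) B)
    (h1 : n < c) (h2 : c ≤ n + 3) (hc : ∀ x : ℤ, n < x → x ≤ n + 3 → (x ∈ A ↔ x = c))
    (hm : ∀ x : ℤ, n < x → x ≤ n + 3 → (x ∈ B ↔ x = n + 2))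
    (h : StableWalk n k d (periodize n (· ∈ A)) (periodize n (· ∈ B))) :
    StableWalk (n + 3) (k + 1) d A B := by
  have := h.insertWindow hn hd (isInsertable_contract hn hA ((hc c h1 h2).2 rfl) h1 h2)
  rwa [insertWindow_contract hA.periodic hc h1, insertWindow_contract hB.periodic hm (by omega)]
    at this

/-- Deleting the three positions after `n`, two of them occupied, and occupying the free position
`y` instead again gives a cyclically stable set. -/
lemma isCyclicStable_contract_insert {n k : ℕ} {A : Set ℤ} {y : ℤ} (hn : 0 < n)
    (hA : IsCyclicStable (n + 3) (k + 1) A) (h1 : (n + 1 : ℤ) ∈ A) (h3 : (n + 3 : ℤ) ∈ A)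
    (hy0 : 0 < y) (hy1 : y ≤ n) (hy : y ∉ A) (hys : y + 1 ∉ A) (hyp : y - 1 ∉ A) :
    IsCyclicStable n k (periodize n fun x => x ∈ A ∨ x = y) where
  periodic := isPeriodicSet_periodize _ _
  succ_notMem := by
    refine succ_notMem_of_window hn (isPeriodicSet_periodize _ _) ?_ ?_
    · intro x hx0 hx1 hx
      rw [mem_periodize (by omega) (by omega)] at hx ⊢
      rcases hx with hx | rfl
      · rintro (h | h)
        · exact hA.succ_notMem x hx h
        · exact hyp (by rwa [show y - 1 = x by omega])
      · rintro (h | h)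
        · exact hys h
        · omega
    · intro _
      rw [mem_periodize (by omega) (by omega)]
      rintro (h | h)
      · exact hA.one_notMem (by push_cast; exact h3) h
      · apply hyp
        rw [← hA.periodic]
        push_cast
        rwa [show y - 1 + ((n : ℤ) + 3) = n + 3 by omega]
  count := by
    classical
    have := hA.count
    unfold windowCount at this ⊢
    have e1 : (Finset.Ioc (0 : ℤ) ((n + 3 : ℕ) : ℤ)).filter (· ∈ A) =
        insert (n + 1 : ℤ) (insert (n + 3 : ℤ) ((Finset.Ioc (0 : ℤ) n).filter (· ∈ A))) := by
      ext x
      simp only [Finset.mem_filter, Finset.mem_Ioc, Finset.mem_insert]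
      push_cast
      constructor
      · rintro ⟨⟨hx0, hx1⟩, hx⟩
        have : x ≠ n + 2 := by
          rintro rfl
          exact hA.succ_notMem _ h1 (by rwa [add_assoc])
        by_cases hxn : x ≤ n
        · exact Or.inr (Or.inr ⟨⟨hx0, hxn⟩, hx⟩)
        · omega
      · rintro (rfl | rfl | ⟨⟨hx0, hx1⟩, hx⟩)
        · exact ⟨by omega, h1⟩
        · exact ⟨by omega, h3⟩
        · exact ⟨by omega, hx⟩
    have e2 : (Finset.Ioc (0 : ℤ) n).filter (· ∈ periodize n fun x => x ∈ A ∨ x = y) =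
        insert y ((Finset.Ioc (0 : ℤ) n).filter (· ∈ A)) := by
      ext x
      simp only [Finset.mem_filter, Finset.mem_Ioc, Finset.mem_insert]
      constructor
      · rintro ⟨⟨hx0, hx1⟩, hx⟩
        rw [mem_periodize hx0 hx1] at hx
        tauto
      · rintro (rfl | ⟨⟨hx0, hx1⟩, hx⟩)
        · exact ⟨⟨hy0, hy1⟩, (mem_periodize hy0 hy1).2 (Or.inr rfl)⟩
        · exact ⟨⟨hx0, hx1⟩, (mem_periodize hx0 hx1).2 (Or.inl hx)⟩
    rw [e2, Finset.card_insert_of_notMem (by simp [hy])]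
    rw [e1, Finset.card_insert_of_notMem, Finset.card_insert_of_notMem] at this
    · omega
    · simp
    · simp

/-- A uses both outer positions, so the first intermediate set must take the middle one. The rest of
the walk then has middle positions at both ends, where length 2 suffices. The added element y only
makes the first disjointness stronger. -/
lemma stableWalk_of_contract_insert {n k d : ℕ} {A B : Set ℤ} {y : ℤ} (hn : 0 < n) (hd : 3 ≤ d)
    (hA : IsCyclicStable (n + 3) (k + 1) A) (hB : IsCyclicStable (n + 3) (k + 1) B)
    (h1 : (n + 1 : ℤ) ∈ A)
    (hm : ∀ x : ℤ, n < x → x ≤ n + 3 → (x ∈ B ↔ x = n + 2))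
    (h : StableWalk n k d (periodize n fun x => x ∈ A ∨ x = y) (periodize n (· ∈ B))) :
    StableWalk (n + 3) (k + 1) d A B := by
  obtain ⟨d, rfl⟩ : ∃ e, d = e + 1 := ⟨d - 1, by omega⟩
  obtain ⟨C, hC, hAC, hCB⟩ := h
  refine ⟨insertWindow n C (n + 2), hC.insertWindow hn (isInsertable_middle _ _), ?_, ?_⟩
  · refine disjoint_of_window (by omega) hA.periodic (isPeriodicSet_periodize _ _)
      fun x hx0 hx1 hxA hxC => ?_
    push_cast at hx1
    rw [mem_insertWindow hx0 hx1] at hxC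
    rcases hxC with ⟨hxn, hxC⟩ | rfl
    · exact Set.disjoint_left.1 hAC ((mem_periodize hx0 hxn).2 (Or.inl hxA)) hxC
    · exact hA.succ_notMem _ h1 (by rwa [add_assoc])
  · have key : StableWalk (n + 3) (k + 1) d (insertWindow n C (n + 2))
        (insertWindow n (periodize n (· ∈ B)) (n + 2)) := by
      rcases (show 2 ≤ d by omega).eq_or_lt with rfl | hd'
      · exact hCB.insertWindow_middle hn
      · exact hCB.insertWindow hn hd' (isInsertable_middle _ _)
    rwa [insertWindow_contract hB.periodic hm (by omega)] at key

/-! ### Gap ends, free positions and the reduction step -/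

/-- Two sets are joined by a walk of length `m` or `m + 1`. -/
def HasStableWalk (n k m : ℕ) (A B : Set ℤ) : Prop :=
  StableWalk n k m A B ∨ StableWalk n k (m + 1) A B

/-- A position which is neither in `A` nor next to an element of `A`. -/
def IsFreePosition (A : Set ℤ) (y : ℤ) : Prop := y - 1 ∉ A ∧ y ∉ A ∧ y + 1 ∉ A

/-- An element of `B` next to a gap of length at least three. -/
def IsGapEnd (B : Set ℤ) (x : ℤ) : Prop := x ∈ B ∧ (x + 2 ∉ B ∨ x - 2 ∉ B)

lemma IsGapEnd.shift {S : Set ℤ} {x : ℤ} (h : IsGapEnd S x) (y : ℤ) :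
    IsGapEnd (shiftSet (x - y) S) y := by
  simp only [IsGapEnd, mem_shiftSet] at h ⊢
  convert h using 3 <;> ring_nf

lemma HasStableWalk.symm {n k m : ℕ} {A B : Set ℤ} (h : HasStableWalk n k m A B)
    (hA : IsCyclicStable n k A) : HasStableWalk n k m B A :=
  h.imp (·.symm hA) (·.symm hA)

lemma HasStableWalk.of_shift {n k m : ℕ} {A B : Set ℤ} (t : ℤ)
    (h : HasStableWalk n k m (shiftSet t A) (shiftSet t B)) : HasStableWalk n k m A B :=
  h.imp (·.of_shift t) (·.of_shift t)

/-- Deleting the window makes n and 1 neighbours; the long gap beside n + 2 keeps one of them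
unoccupied. -/
lemma IsGapEnd.one_notMem {n k : ℕ} {B : Set ℤ} (hB : IsCyclicStable (n + 3) k B)
    (h : IsGapEnd B (n + 2)) (hn : (n : ℤ) ∈ B) : (1 : ℤ) ∉ B := by
  rcases h.2 with h | h
  · rw [← hB.periodic]
    push_cast
    rwa [show (1 : ℤ) + (n + 3) = n + 2 + 2 by ring]
  · simp [hn] at h

lemma IsCyclicStable.mem_window_iff {n k : ℕ} {S : Set ℤ} (hS : IsCyclicStable n k S) {a c : ℤ}
    (hc : c ∈ S) (hac : a ≤ c) (hca : c ≤ a + 2) (h : c = a → a + 2 ∉ S) (h' : c = a + 2 → a ∉ S)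
    {x : ℤ} (hx : a ≤ x) (hx' : x ≤ a + 2) : x ∈ S ↔ x = c := by
  refine ⟨fun hxS => ?_, fun h => h ▸ hc⟩
  have h1 := hS.succ_notMem c hc
  have h2 := hS.succ_notMem x hxS
  by_contra hne
  have h3 : x ≠ c + 1 := fun e => h1 (e ▸ hxS)
  have h4 : c ≠ x + 1 := fun e => h2 (e ▸ hc)
  rcases lt_or_gt_of_ne hne with hlt | hlt
  · exact h' (by omega) (by rwa [show a = x by omega])
  · exact h (by omega) (by rwa [show a + 2 = x by omega])

section Reduction

variable {n k m : ℕ} {A B : Set ℤ}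

lemma hasStableWalk_of_mem_window (hn : 0 < n) (hm : 3 ≤ m)
    (ih : ∀ T U, IsCyclicStable n k T → IsCyclicStable n k U → HasStableWalk n k m T U)
    (hA : IsCyclicStable (n + 3) (k + 1) A) (hB : IsCyclicStable (n + 3) (k + 1) B)
    (hx : IsGapEnd B (n + 2)) {c : ℤ} (h1 : n < c) (h2 : c ≤ n + 3)
    (hc : ∀ x : ℤ, n < x → x ≤ n + 3 → (x ∈ A ↔ x = c)) (h : (n : ℤ) ∈ A → (1 : ℤ) ∉ A) :
    HasStableWalk (n + 3) (k + 1) m A B := by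
  have hB' : ∀ x : ℤ, n < x → x ≤ n + 3 → (x ∈ B ↔ x = n + 2) := fun x hx1 hx2 =>
    hB.mem_window_iff (a := n + 1) hx.1 (by omega) (by omega) (by omega) (by omega) (by omega)
      (by omega)
  exact (ih _ _ (isCyclicStable_contract hn hA h1 h2 hc h)
    (isCyclicStable_contract hn hB (by omega) (by omega) hB' (hx.one_notMem hB))).imp
    (stableWalk_of_contract hn hm hA hB h1 h2 hc hB')
    (stableWalk_of_contract hn (by omega) hA hB h1 h2 hc hB')

lemma hasStableWalk_of_isGapEnd_of_isGapEnd (hn : 0 < n) (hm : 3 ≤ m)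
    (ih : ∀ T U, IsCyclicStable n k T → IsCyclicStable n k U → HasStableWalk n k m T U)
    (hA : IsCyclicStable (n + 3) (k + 1) A) (hB : IsCyclicStable (n + 3) (k + 1) B) {x : ℤ}
    (hxB : IsGapEnd B x) (hxA : IsGapEnd A x) : HasStableWalk (n + 3) (k + 1) m A B := by
  -- This translation moves x to n + 2, the middle of the last three positions of the period.
  apply HasStableWalk.of_shift (x - (n + 2))
  have hA' := hA.shift (x - (n + 2))
  refine hasStableWalk_of_mem_window hn hm ih hA' (hB.shift _) (hxB.shift _) (c := n + 2)
    (by omega) (by omega) (fun z h1 h2 => ?_) ((hxA.shift (n + 2)).one_notMem hA')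
  exact hA'.mem_window_iff (a := n + 1) (hxA.shift (n + 2)).1 (by omega) (by omega) (by omega) (by omega)
    (by omega) (by omega)

lemma hasStableWalk_of_pred_mem (hn : 0 < n) (hm : 3 ≤ m)
    (ih : ∀ T U, IsCyclicStable n k T → IsCyclicStable n k U → HasStableWalk n k m T U)
    (hA : IsCyclicStable (n + 3) (k + 1) A) (hB : IsCyclicStable (n + 3) (k + 1) B) {x : ℤ}
    (hxB : IsGapEnd B x) (h : x - 1 ∈ A) (h' : x + 1 ∉ A) :
    HasStableWalk (n + 3) (k + 1) m A B := by
  apply HasStableWalk.of_shift (x - (n + 2))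
  have hA' := hA.shift (x - (n + 2))
  refine hasStableWalk_of_mem_window hn hm ih hA' (hB.shift _) (hxB.shift _) (c := n + 1)
    (by omega) (by omega) (fun z h1 h2 => ?_) ?_
  · refine hA'.mem_window_iff (a := n + 1) ?_ (by omega) (by omega) (fun _ => ?_) (by omega)
      (by omega) (by omega)
    · rw [mem_shiftSet]; convert h using 1; ring
    · rw [mem_shiftSet]; convert h' using 2; ring
  · intro hnA
    exfalso
    refine hA'.succ_notMem _ hnA ?_
    rw [mem_shiftSet]; convert h using 1; ring

lemma hasStableWalk_of_succ_mem (hn : 0 < n) (hm : 3 ≤ m)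
    (ih : ∀ T U, IsCyclicStable n k T → IsCyclicStable n k U → HasStableWalk n k m T U)
    (hA : IsCyclicStable (n + 3) (k + 1) A) (hB : IsCyclicStable (n + 3) (k + 1) B) {x : ℤ}
    (hxB : IsGapEnd B x) (h : x - 1 ∉ A) (h' : x + 1 ∈ A) :
    HasStableWalk (n + 3) (k + 1) m A B := by
  apply HasStableWalk.of_shift (x - (n + 2))
  have hA' := hA.shift (x - (n + 2))
  have h3 : ((n + 3 : ℕ) : ℤ) ∈ shiftSet (x - (n + 2)) A := by
    rw [mem_shiftSet]; convert h' using 1; push_cast; ring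
  refine hasStableWalk_of_mem_window hn hm ih hA' (hB.shift _) (hxB.shift _) (c := n + 3)
    (by omega) (by omega) (fun z h1 h2 => ?_) fun _ => hA'.one_notMem h3
  · refine hA'.mem_window_iff (a := n + 1) (by exact_mod_cast h3) (by omega) (by omega) (by omega)
      (fun _ => ?_) (by omega) (by omega)
    rw [mem_shiftSet]; convert h using 2; ring

lemma hasStableWalk_of_isFreePosition (hn : 0 < n) (hm : 3 ≤ m)
    (ih : ∀ T U, IsCyclicStable n k T → IsCyclicStable n k U → HasStableWalk n k m T U)
    (hA : IsCyclicStable (n + 3) (k + 1) A) (hB : IsCyclicStable (n + 3) (k + 1) B) {x y : ℤ}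
    (hy : IsFreePosition A y) (hxB : IsGapEnd B x) (h : x - 1 ∈ A) (h' : x + 1 ∈ A) :
    HasStableWalk (n + 3) (k + 1) m A B := by
  apply HasStableWalk.of_shift (x - (n + 2))
  set t : ℤ := x - (n + 2)
  have hA' := hA.shift t
  have hB' := hB.shift t
  have h1 : (n + 1 : ℤ) ∈ shiftSet t A := by
    rw [mem_shiftSet]; convert h using 1; ring
  have h3 : (n + 3 : ℤ) ∈ shiftSet t A := by
    rw [mem_shiftSet]; convert h' using 1; ring
  have hxB' : IsGapEnd (shiftSet t B) (n + 2) := hxB.shift _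
  obtain ⟨q, hq0, hq1⟩ := exists_mul_add_mem_window (n := n + 3) (by omega) (y - t)
  set z : ℤ := y - t + (n + 3 : ℕ) * q
  have hz : ∀ s : ℤ, z + s ∈ shiftSet t A ↔ y + s ∈ A := by
    intro s
    rw [mem_shiftSet, ← hA.periodic.add_mul (y + s) q]
    simp only [z]
    ring_nf
  have hz0 : z ∉ shiftSet t A := by simpa using (hz 0).not.2 (by simpa using hy.2.1)
  have hzs : z + 1 ∉ shiftSet t A := (hz 1).not.2 hy.2.2
  have hzp : z - 1 ∉ shiftSet t A := (hz (-1)).not.2 hy.1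
  -- The free position survives the deletion, because every position of the window is in A or next
  -- to an element of A.
  have hzn : z ≤ n := by
    by_contra hlt
    push_cast at hq1
    obtain h | h | h : z = n + 1 ∨ z = n + 2 ∨ z = n + 3 := by omega
    · exact hz0 (h ▸ h1)
    · exact hzp (by rwa [h, show (n : ℤ) + 2 - 1 = n + 1 by ring])
    · exact hz0 (h ▸ h3)
  have hBw : ∀ x : ℤ, n < x → x ≤ n + 3 → (x ∈ shiftSet t B ↔ x = n + 2) := fun x hx1 hx2 =>
    hB'.mem_window_iff (a := n + 1) hxB'.1 (by omega) (by omega) (by omega) (by omega) (by omega)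
      (by omega)
  exact (ih _ _ (isCyclicStable_contract_insert hn hA' h1 h3 hq0 hzn hz0 hzs hzp)
    (isCyclicStable_contract hn hB' (by omega) (by omega) hBw (hxB'.one_notMem hB'))).imp
    (stableWalk_of_contract_insert hn hm hA' hB' h1 hBw)
    (stableWalk_of_contract_insert hn (by omega) hA' hB' h1 hBw)

/-- What remains at a gap end of `B` when no reduction is possible. -/
lemma gapEnd_cases (hn : 0 < n) (hm : 3 ≤ m)
    (ih : ∀ T U, IsCyclicStable n k T → IsCyclicStable n k U → HasStableWalk n k m T U)
    (hA : IsCyclicStable (n + 3) (k + 1) A) (hB : IsCyclicStable (n + 3) (k + 1) B)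
    (hAB : ¬ HasStableWalk (n + 3) (k + 1) m A B) {x y : ℤ}
    (hy : IsFreePosition A y) (hxB : IsGapEnd B x) :
    IsFreePosition A x ∨ (x - 2 ∈ A ∧ x ∈ A ∧ x + 2 ∈ A) := by
  by_cases hx : x ∈ A
  · right
    by_contra h
    refine hAB (hasStableWalk_of_isGapEnd_of_isGapEnd hn hm ih hA hB hxB ⟨hx, ?_⟩)
    tauto
  · left
    by_cases h1 : x - 1 ∈ A <;> by_cases h2 : x + 1 ∈ A
    · exact absurd (hasStableWalk_of_isFreePosition hn hm ih hA hB hy hxB h1 h2) hAB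
    · exact absurd (hasStableWalk_of_pred_mem hn hm ih hA hB hxB h1 h2) hAB
    · exact absurd (hasStableWalk_of_succ_mem hn hm ih hA hB hxB h1 h2) hAB
    · exact ⟨h1, hx, h2⟩

/-- By periodicity y may be moved to the right of a, where one of y - 1 and y is in the progression.
-/
lemma IsCyclicStable.not_isFreePosition_of_add_two {N K : ℕ} {S : Set ℤ} (hN : 0 < N)
    (hS : IsCyclicStable N K S) {a : ℤ}
    (ha : ∀ i : ℕ, a + 2 * i ∈ S) (y : ℤ) : ¬ IsFreePosition S y := by
  rintro ⟨h1, h2, -⟩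
  obtain ⟨j, hj⟩ : ∃ j : ℕ, a ≤ y - 1 + N * j := by
    refine ⟨(a - y + 1).toNat, ?_⟩
    have := Int.self_le_toNat (a - y + 1)
    nlinarith
  rw [← hS.periodic.add_mul _ j] at h1 h2
  obtain ⟨i, hi | hi⟩ := Nat.even_or_odd' (y - 1 + N * j - a).toNat
  · apply h1
    convert ha i using 1
    omega
  · apply h2
    convert ha (i + 1) using 1
    push_cast
    omega

lemma hasStableWalk_of_isFreePosition_both (hn : 0 < n) (hm : 3 ≤ m)
    (ih : ∀ T U, IsCyclicStable n k T → IsCyclicStable n k U → HasStableWalk n k m T U)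
    (hA : IsCyclicStable (n + 3) (k + 1) A) (hB : IsCyclicStable (n + 3) (k + 1) B) {y z : ℤ}
    (hy : IsFreePosition A y) (hz : IsFreePosition B z) :
    HasStableWalk (n + 3) (k + 1) m A B := by
  by_contra hAB
  have hBA : ¬ HasStableWalk (n + 3) (k + 1) m B A := fun h => hAB (h.symm hB)
  -- A single pair a ∈ A, a + 1 ∈ B would propagate: `gapEnd_cases`, applied alternately with A and
  -- B exchanged, forces a + 2 ∈ A and a + 3 ∈ B, and so on, leaving A no free position.
  have key : ∀ a ∈ A, a + 1 ∉ B := by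
    intro a ha hb
    have step : ∀ i : ℕ, a + 2 * i ∈ A ∧ a + 2 * i + 1 ∈ B := by
      intro i
      induction i with
      | zero => simpa using ⟨ha, hb⟩
      | succ i hi =>
        obtain ⟨h1, h2⟩ := hi
        have h3 : a + 2 * i + 2 ∈ A := by
          by_contra h
          rcases gapEnd_cases hn hm ih hB hA hBA hz ⟨h1, Or.inl h⟩ with h' | h'
          · exact h'.2.2 h2
          · exact hB.succ_notMem _ h'.2.1 h2
        have h4 : a + 2 * i + 1 + 2 ∈ B := by
          by_contra h
          rcases gapEnd_cases hn hm ih hA hB hAB hy ⟨h2, Or.inl h⟩ with h' | h'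
          · exact h'.1 (by simpa using h1)
          · exact hA.succ_notMem _ h1 h'.2.1
        push_cast
        exact ⟨by convert h3 using 1; ring, by convert h4 using 1; ring⟩
    exact hA.not_isFreePosition_of_add_two (by omega) (fun i => (step i).1) y hy
  apply hAB
  -- The walk A, A + 1, B, where A + 1 is `shiftSet (-1) A`.
  refine StableWalk.exists_eq_or_eq_succ (d := 2) hA ⟨shiftSet (-1) A, hA.shift _, ?_, B, hB, ?_,
    rfl⟩ (by omega)
  · refine Set.disjoint_left.2 fun x hx hx' => hA.succ_notMem (x + -1) hx' ?_
    simpa using hx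
  · refine Set.disjoint_left.2 fun x hx hx' => key (x + -1) hx ?_
    simpa using hx'

/-- If all gaps had length 2, then S and its translate by one would cover everything, forcing N =
2K. -/
lemma IsCyclicStable.exists_add_two_notMem {N K : ℕ} {S : Set ℤ} (hS : IsCyclicStable N K S)
    (hK : 0 < K) (hN : 2 * K < N) : ∃ b ∈ S, b + 2 ∉ S := by
  by_contra! h
  obtain ⟨a, ha⟩ : S.Nonempty := by
    by_contra! he
    have := hS.count
    simp [windowCount, he] at this
    omega
  have hi : ∀ i : ℕ, a + 2 * i ∈ S := by
    intro i
    induction i with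
    | zero => simpa using ha
    | succ i ih => convert h _ ih using 1; push_cast; ring
  have hu : S ∪ shiftSet 1 S = Set.univ := by
    ext x
    simp only [Set.mem_union, Set.mem_univ, iff_true, mem_shiftSet]
    by_contra! hx
    refine hS.not_isFreePosition_of_add_two (by omega) hi x ⟨fun hx' => ?_, hx⟩
    have := h _ hx'
    rw [show x - 1 + 2 = x + 1 by ring] at this
    exact hx.2 this
  have := windowCount_univ N
  rw [← hu, windowCount_union hS.disjoint_shift_one, windowCount_shift hS.periodic, hS.count] at this
  omega

lemma hasStableWalk_of_isFreePosition_left (hn : 0 < n) (hm : 3 ≤ m) (hnk : 2 * k < n + 1)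
    (ih : ∀ T U, IsCyclicStable n k T → IsCyclicStable n k U → HasStableWalk n k m T U)
    (hA : IsCyclicStable (n + 3) (k + 1) A) (hB : IsCyclicStable (n + 3) (k + 1) B) {y : ℤ}
    (hy : IsFreePosition A y) (hz : ∀ z, ¬ IsFreePosition B z) :
    HasStableWalk (n + 3) (k + 1) m A B := by
  by_contra hAB
  -- The alternatives of `gapEnd_cases` at the two ends b and b + 3 are compatible only if both ends
  -- are free in A.
  have gap : ∀ b ∈ B, b + 2 ∉ B → b + 3 ∈ B ∧ b ∉ A ∧ b + 1 ∉ A ∧ b + 2 ∉ A := by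
    intro b hb hb2
    have hb1 := hB.succ_notMem b hb
    have hb3 : b + 3 ∈ B := by
      by_contra hb3
      refine hz (b + 2) ⟨?_, hb2, ?_⟩
      · rwa [show b + 2 - 1 = b + 1 by ring]
      · rwa [show b + 2 + 1 = b + 3 by ring]
    have c1 := gapEnd_cases hn hm ih hA hB hAB hy ⟨hb, Or.inl hb2⟩
    have c2 := gapEnd_cases hn hm ih hA hB hAB hy (x := b + 3)
      ⟨hb3, Or.inr (by rwa [show b + 3 - 2 = b + 1 by ring])⟩
    simp only [IsFreePosition] at c1 c2
    rw [show b + 3 - 1 = b + 2 by ring, show b + 3 - 2 = b + 1 by ring] at c2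
    have s1 := hA.succ_notMem b
    have s2 := hA.succ_notMem (b + 1)
    rw [show b + 1 + 1 = b + 2 by ring] at s2
    tauto
  obtain ⟨b, hb, hb2⟩ := hB.exists_add_two_notMem (by omega) (by omega)
  -- Map a ∈ A to a + 1 if that lies in B and to a + 2 otherwise; A₁ and A₂ are the two parts of the
  -- image. The map is injective since A has no neighbours, and it misses b + 3 since b + 1 and b +
  -- 2 are not in A.
  set A₁ : Set ℤ := shiftSet (-1) A ∩ B
  set A₂ : Set ℤ := shiftSet (-2) {a | a ∈ A ∧ a + 1 ∉ B}
  have hA' : ∀ a ∈ A, a + 1 ∉ B → a + 2 ∈ B := by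
    intro a ha h1
    by_contra h2
    by_cases h0 : a ∈ B
    · exact (gap a h0 h2).2.1 ha
    · exact hz (a + 1) ⟨by simpa using h0, h1, by rwa [show a + 1 + 1 = a + 2 by ring]⟩
  have hpB := hB.periodic
  have hpA := hA.periodic
  have hp : IsPeriodicSet (n + 3) {a | a ∈ A ∧ a + 1 ∉ B} := by
    intro x
    simp only [Set.mem_ofPred_eq]
    rw [hpA, add_right_comm, hpB]
  have hp1 : IsPeriodicSet (n + 3) A₁ := by
    intro x
    have := (hpA.shift (-1)) x
    simp only [A₁, Set.mem_inter_iff, hpB x, this]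
  have hdisj : Disjoint A₁ A₂ := by
    refine Set.disjoint_left.2 fun x hx hx' => ?_
    have h1 : x + -1 ∈ A := hx.1
    have h2 : x + -2 ∈ A := hx'.1
    refine hA.succ_notMem _ h2 ?_
    rwa [show x + -2 + 1 = x + -1 by ring]
  have hsub : A₁ ∪ A₂ ⊆ B := by
    rintro x (hx | hx)
    · exact hx.2
    · have := hA' _ hx.1 hx.2
      rwa [show x + -2 + 2 = x by ring] at this
  have hlt : windowCount (n + 3) (A₁ ∪ A₂) < windowCount (n + 3) B := by
    refine windowCount_lt (by omega) ?_ hpB hsub (gap b hb hb2).1 ?_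
    · intro x
      simp only [Set.mem_union, hp1 x, (hp.shift (-2)) x, A₂]
    · obtain ⟨-, -, g1, g2⟩ := gap b hb hb2
      rintro (h | h)
      · refine g2 ?_
        have : b + 3 + -1 ∈ A := h.1
        rwa [show b + 3 + -1 = b + 2 by ring] at this
      · refine g1 ?_
        have : b + 3 + -2 ∈ A := h.1
        rwa [show b + 3 + -2 = b + 1 by ring] at this
  have hAeq : A = shiftSet 1 A₁ ∪ {a | a ∈ A ∧ a + 1 ∉ B} := by
    ext x
    simp only [A₁, Set.mem_union, mem_shiftSet, Set.mem_inter_iff, Set.mem_ofPred_eq]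
    rw [show x + 1 + -1 = x by ring]
    tauto
  have hcA : windowCount (n + 3) A = windowCount (n + 3) A₁ + windowCount (n + 3) A₂ := by
    rw [windowCount_shift hp, ← windowCount_shift hp1 1, ← windowCount_union, ← hAeq]
    exact Set.disjoint_left.2 fun x hx hx' => hx'.2 hx.2
  rw [windowCount_union hdisj, ← hcA, hA.count, hB.count] at hlt
  exact lt_irrefl _ hlt

end Reduction

/-! ### Sets with gaps of length two and three -/

/-- A sequence with period `r` modulo `n` and odd increments of at least three: the left ends of
the gaps of length three in a set all of whose gaps have length two or three. -/
structure IsGapSequence (n r : ℕ) (c : ℤ → ℤ) : Prop where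
  add_period : ∀ v, c (v + r) = c v + n
  add_three_le : ∀ v, c v + 3 ≤ c (v + 1)
  odd : ∀ v, (c (v + 1) - c v) % 2 = 1

/-- The set with gaps of length two or three whose gaps of length three begin at the values
of `c`. -/
def gapSet (c : ℤ → ℤ) : Set ℤ :=
  {x | ∃ v, c v + 3 ≤ x ∧ x ≤ c (v + 1) ∧ (c (v + 1) - x) % 2 = 0}

lemma mem_gapSet {c : ℤ → ℤ} {x : ℤ} :
    x ∈ gapSet c ↔ ∃ v, c v + 3 ≤ x ∧ x ≤ c (v + 1) ∧ (c (v + 1) - x) % 2 = 0 := Iff.rfl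

namespace IsGapSequence

variable {n r : ℕ} {c e : ℤ → ℤ}

lemma add_three_mul_le (hc : IsGapSequence n r c) (v : ℤ) (i : ℕ) : c v + 3 * i ≤ c (v + i) := by
  induction i with
  | zero => simp
  | succ i ih =>
    have := hc.add_three_le (v + i)
    push_cast
    rw [← add_assoc]
    linarith

lemma add_mul_sub_le (hc : IsGapSequence n r c) {v w : ℤ} (h : v ≤ w) :
    c v + 3 * (w - v) ≤ c w := by
  obtain ⟨i, rfl⟩ := Int.le.dest h
  have := hc.add_three_mul_le v i
  linarith

lemma strictMono (hc : IsGapSequence n r c) : StrictMono c := fun v w h => by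
  have := hc.add_mul_sub_le h.le
  linarith

lemma reindex (hc : IsGapSequence n r c) (j : ℤ) : IsGapSequence n r fun v => c (v - j) where
  add_period v := by rw [← hc.add_period]; ring_nf
  add_three_le v := by have := hc.add_three_le (v - j); rwa [sub_add_eq_add_sub] at this
  odd v := by have := hc.odd (v - j); rwa [sub_add_eq_add_sub] at this

lemma add_mul_period (hc : IsGapSequence n r c) (v q : ℤ) : c (v + r * q) = c v + n * q := by
  induction q using Int.induction_on with
  | zero => simp
  | succ i ih =>
    have := hc.add_period (v + r * i)
    rw [show v + r * ((i : ℤ) + 1) = v + r * i + r by ring]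
    linarith
  | pred i ih =>
    have := hc.add_period (v + r * (-i - 1))
    rw [show v + r * (-(i : ℤ) - 1) + r = v + r * (-i) by ring] at this
    linarith

lemma exists_lt_le (hc : IsGapSequence n r c) (x : ℤ) : ∃ v, c v < x ∧ x ≤ c (v + 1) := by
  obtain ⟨v, h1, h2⟩ := Int.exists_greatest_of_bdd (P := fun v => c v < x)
    ⟨max 0 (x - c 0), fun v hv => by
      by_contra! h
      have := hc.add_mul_sub_le (v := 0) (w := v) (by omega)
      omega⟩
    ⟨-max 0 (c 0 - x + 1), by
      have := hc.add_mul_sub_le (v := -max 0 (c 0 - x + 1)) (w := 0) (by omega)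
      omega⟩
  refine ⟨v, h1, ?_⟩
  by_contra! h
  have := h2 _ h
  omega

lemma mem_gapSet_self (hc : IsGapSequence n r c) (v : ℤ) : c v ∈ gapSet c := by
  refine ⟨v - 1, ?_, ?_, ?_⟩
  · simpa using hc.add_three_le (v - 1)
  · simp
  · simp

lemma isPeriodicSet_gapSet (hc : IsGapSequence n r c) : IsPeriodicSet n (gapSet c) := by
  intro x
  constructor
  · rintro ⟨v, h1, h2, h3⟩
    have e1 := hc.add_period (v - r)
    have e2 := hc.add_period (v - r + 1)
    rw [sub_add_cancel] at e1
    rw [show v - (r : ℤ) + 1 + r = v + 1 by ring] at e2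
    exact ⟨v - r, by omega, by omega, by omega⟩
  · rintro ⟨v, h1, h2, h3⟩
    have e1 := hc.add_period v
    have e2 := hc.add_period (v + 1)
    rw [show v + 1 + (r : ℤ) = v + r + 1 by ring] at e2
    exact ⟨v + r, by omega, by omega, by omega⟩

lemma succ_notMem_gapSet (hc : IsGapSequence n r c) : ∀ x ∈ gapSet c, x + 1 ∉ gapSet c := by
  rintro x ⟨v, h1, h2, h3⟩ ⟨w, h4, h5, h6⟩
  rcases lt_trichotomy v w with h | rfl | h
  · have := hc.strictMono.monotone (show v + 1 ≤ w by omega)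
    omega
  · omega
  · have := hc.strictMono.monotone (show w + 1 ≤ v by omega)
    omega

lemma isPeriodicSet_range (hc : IsGapSequence n r c) : IsPeriodicSet n (Set.range c) := by
  intro x
  constructor
  · rintro ⟨v, hv⟩
    have := hc.add_period (v - r)
    rw [sub_add_cancel] at this
    exact ⟨v - r, by omega⟩
  · rintro ⟨v, hv⟩
    exact ⟨v + r, by rw [hc.add_period, hv]⟩

lemma windowCount_range (hc : IsGapSequence n r c) : windowCount n (Set.range c) = r := by
  classical
  obtain ⟨v, hv0, hv1⟩ := hc.exists_lt_le 1
  have hp := hc.add_period v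
  have hp1 := hc.add_period (v + 1)
  unfold windowCount
  have : (Finset.Ioc (0 : ℤ) n).filter (· ∈ Set.range c) = (Finset.Ioc v (v + r)).image c := by
    ext x
    simp only [Finset.mem_filter, Finset.mem_Ioc, Set.mem_range, Finset.mem_image]
    constructor
    · rintro ⟨⟨h0, h1⟩, w, rfl⟩
      refine ⟨w, ⟨?_, ?_⟩, rfl⟩
      · by_contra! h
        have := hc.strictMono.monotone h
        omega
      · by_contra! h
        have := hc.strictMono.monotone (show v + 1 + r ≤ w by omega)
        omega
    · rintro ⟨w, ⟨h0, h1⟩, rfl⟩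
      have h2 := hc.strictMono.monotone (show v + 1 ≤ w by omega)
      have h3 := hc.strictMono.monotone h1
      exact ⟨by omega, w, rfl⟩
  rw [this, Finset.card_image_of_injective _ hc.strictMono.injective]
  simp

/-- Each element covers itself and its successor, and each long gap leaves one further position. The
three pieces are disjoint, so counting them yields n = 2k + r. -/
lemma univ_eq (hc : IsGapSequence n r c) :
    (Set.univ : Set ℤ) = gapSet c ∪ shiftSet (-1) (gapSet c) ∪ shiftSet (-2) (Set.range c) := by
  symm
  refine Set.eq_univ_of_forall fun x => ?_
  obtain ⟨v, h1, h2⟩ := hc.exists_lt_le x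
  simp only [Set.mem_union, mem_shiftSet]
  have ho := hc.odd v
  obtain h | h | h : x = c v + 1 ∨ x = c v + 2 ∨ c v + 3 ≤ x := by omega
  · exact Or.inl (Or.inr (by simpa [h] using hc.mem_gapSet_self v))
  · exact Or.inr ⟨v, by omega⟩
  · by_cases hx : (c (v + 1) - x) % 2 = 0
    · exact Or.inl (Or.inl ⟨v, h, h2, hx⟩)
    · exact Or.inl (Or.inr ⟨v, by omega, by omega, by omega⟩)

lemma notMem_gapSet (hc : IsGapSequence n r c) (v : ℤ) : c v + 2 ∉ gapSet c := by
  rintro ⟨w, h1, h2, -⟩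
  have h3 : w < v := hc.strictMono.lt_iff_lt.1 (show c w < c v by omega)
  have := hc.strictMono.monotone (show w + 1 ≤ v by omega)
  omega

lemma windowCount_gapSet (hc : IsGapSequence n r c) : 2 * windowCount n (gapSet c) + r = n := by
  have h := windowCount_univ n
  rw [hc.univ_eq, windowCount_union, windowCount_union, windowCount_shift hc.isPeriodicSet_gapSet,
    windowCount_shift hc.isPeriodicSet_range, hc.windowCount_range] at h
  · omega
  · refine Set.disjoint_left.2 fun x hx hx' => hc.succ_notMem_gapSet (x + -1) hx' ?_
    simpa using hx
  · refine Set.disjoint_left.2 fun x hx ⟨v, hv⟩ => ?_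
    rcases hx with hx | hx
    · exact hc.notMem_gapSet v (by rwa [hv, show x + -2 + 2 = x by ring])
    · refine hc.succ_notMem_gapSet _ (hc.mem_gapSet_self v) ?_
      rw [hv, show x + -2 + 1 = x + -1 by ring]
      exact hx

lemma isCyclicStable {k : ℕ} (hc : IsGapSequence n r c) (hn : n = 2 * k + r) :
    IsCyclicStable n k (gapSet c) where
  periodic := hc.isPeriodicSet_gapSet
  succ_notMem := hc.succ_notMem_gapSet
  count := by
    have := hc.windowCount_gapSet
    omega

/-- Between consecutive long gaps the elements have constant parity, and the move by one reverses
it. -/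
lemma disjoint_gapSet (he : IsGapSequence n r e)
    (h : ∀ v, e v = c v + 1 ∨ e v = c v - 1) : Disjoint (gapSet c) (gapSet e) := by
  refine Set.disjoint_left.2 ?_
  rintro x ⟨v, h1, h2, h3⟩ ⟨w, h4, h5, h6⟩
  have hv := h v
  have hv1 := h (v + 1)
  rcases lt_trichotomy v w with hvw | rfl | hvw
  · have := he.strictMono.monotone (show v + 1 ≤ w by omega)
    omega
  · omega
  · have := he.strictMono.monotone (show w + 1 ≤ v by omega)
    omega

lemma stableWalk {k d : ℕ} (hn : n = 2 * k + r) (hc : IsGapSequence n r c)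
    (he : IsGapSequence n r e) (h : ∀ v, |c v - e v| ≤ d) (hp : ∀ v, (c v - e v - d) % 2 = 0) :
    StableWalk n k d (gapSet c) (gapSet e) := by
  induction d generalizing c with
  | zero =>
    have : c = e := by
      ext v
      have := abs_le.1 (h v)
      push_cast at this
      omega
    rw [this]
    rfl
  | succ d ih =>
    have h' : ∀ v, -(d + 1 : ℤ) ≤ c v - e v ∧ c v - e v ≤ d + 1 := fun v => by
      exact_mod_cast abs_le.1 (h v)
    push_cast at hp
    -- Each long gap steps towards its target, or steps off it when already there; parity then
    -- leaves enough steps to return. Two long gaps at distance 3 never approach each other, since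
    -- their targets are also at least 3 apart and in order.
    set f : ℤ → ℤ := fun v => if e v < c v then c v - 1 else c v + 1 with hf
    have hf1 : IsGapSequence n r f := by
      refine ⟨fun v => ?_, fun v => ?_, fun v => ?_⟩
      · simp only [hf, hc.add_period, he.add_period]
        split_ifs <;> omega
      · have h1 := hc.add_three_le v
        have h2 := he.add_three_le v
        have h3 := hc.odd v
        simp only [hf]
        split_ifs <;> omega
      · have h3 := hc.odd v
        simp only [hf]
        split_ifs <;> omega
    refine ⟨gapSet f, hf1.isCyclicStable hn, hf1.disjoint_gapSet fun v => ?_, ih hf1 ?_ ?_⟩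
    · simp only [hf]
      split_ifs <;> omega
    · intro v
      have h1 := h' v
      have h2 := hp v
      rw [abs_le]
      simp only [hf]
      split_ifs <;> omega
    · intro v
      have h2 := hp v
      simp only [hf]
      split_ifs <;> omega

lemma gapSet_reindex (c : ℤ → ℤ) (j : ℤ) : gapSet (fun v => c (v - j)) = gapSet c := by
  ext x
  simp only [mem_gapSet]
  constructor
  · rintro ⟨v, hv⟩
    exact ⟨v - j, by rwa [sub_add_eq_add_sub]⟩
  · rintro ⟨v, hv⟩
    exact ⟨v + j, by rwa [add_sub_cancel_right, add_right_comm, add_sub_cancel_right]⟩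

lemma parity_sub (hc : IsGapSequence n r c) (he : IsGapSequence n r e) (v : ℤ) :
    (c v - e v) % 2 = (c 0 - e 0) % 2 := by
  induction v using Int.induction_on with
  | zero => rfl
  | succ i ih =>
    have h1 := hc.odd i
    have h2 := he.odd i
    omega
  | pred i ih =>
    have h1 := hc.odd (-i - 1)
    have h2 := he.odd (-i - 1)
    rw [sub_add_cancel] at h1 h2
    omega

/-- Two gap sequences can be aligned so that corresponding gaps are close to each other. -/
lemma exists_reindex_close {m : ℕ} (hn : n = 3 * r + 2 * m) (hr : 0 < r)
    (hc : IsGapSequence n r c) (he : IsGapSequence n r e) :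
    ∃ j, ∀ v, |c v - e (v - j)| ≤ m + 1 := by
  -- The extremal alignment: the least j respecting the lower bound. Failure of the upper bound at
  -- v, and of the lower bound for j - 1 at some w, will be contradictory.
  obtain ⟨j, hj, hmin⟩ := Int.exists_least_of_bdd
    (P := fun j => ∀ v, -(m + 1 : ℤ) ≤ c v - e (v - j))
    ⟨min 0 (e 0 - c 0 - m - 1), fun j hj => by
      by_contra! h
      have h1 := hj 0
      have h2 := he.add_mul_sub_le (v := 0) (w := 0 - j) (by omega)
      omega⟩
    ⟨r + |e 0 - c 0|, fun v => by
      have hr' : (0 : ℤ) < r := by exact_mod_cast hr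
      have h0 := Int.emod_add_mul_ediv v r
      have h1 := Int.emod_nonneg v hr'.ne'
      have h2 := Int.emod_lt_of_pos v hr'
      have h3 := hc.add_mul_period (v % r) (v / r)
      have h4 := he.add_mul_period (v % r - (r + |e 0 - c 0|)) (v / r)
      rw [h0] at h3
      rw [sub_add_eq_add_sub, h0] at h4
      rw [h3, h4]
      have h5 := hc.add_mul_sub_le h1
      have h6 := he.add_mul_sub_le
        (show v % r - (r + |e 0 - c 0|) ≤ 0 by have := abs_nonneg (e 0 - c 0); omega)
      have h7 := le_abs_self (e 0 - c 0)
      have h8 := abs_nonneg (e 0 - c 0)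
      omega⟩
  refine ⟨j, fun v => abs_le.2 ⟨hj v, ?_⟩⟩
  by_contra! hv
  have hnot : ¬ ∀ v, -(m + 1 : ℤ) ≤ c v - e (v - (j - 1)) := fun h => by
    have := hmin _ h
    omega
  push Not at hnot
  obtain ⟨w, hw⟩ := hnot
  obtain ⟨q, hq0, hq1⟩ := exists_mul_add_mem_window hr (v - w)
  -- Now u < v ≤ u + r. Spacing at least 3 on both sides bounds the difference of the two
  -- displacements by n - 3r + 3 = 2m + 3, whereas the violations make it at least 2m + 4.
  set u : ℤ := w + r * (-q) with hu
  have hu1 : c u - e (u - (j - 1)) < -(m + 1 : ℤ) := by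
    have h1 := hc.add_mul_period w (-q)
    have h2 := he.add_mul_period (w - (j - 1)) (-q)
    rw [show w - (j - 1) + r * (-q) = u - (j - 1) by rw [hu]; ring] at h2
    rw [h1, h2]
    linarith
  have huv : v - u = v - w + r * q := by rw [hu]; ring
  have h1 := hc.add_mul_sub_le (show v ≤ u + r by omega)
  rw [hc.add_period] at h1
  have h2 := he.add_mul_sub_le (show u - (j - 1) ≤ v - j by omega)
  push_cast [hn] at h1
  linarith

end IsGapSequence

/-! ### From sets without free positions to gap sequences -/

/-- Enumeration of a nonempty periodic set of integers. -/
lemma IsPeriodicSet.exists_strictMono {n r : ℕ} {D : Set ℤ} (hn : 0 < n) (hD : IsPeriodicSet n D)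
    (hr : 0 < r) (hcard : windowCount n D = r) :
    ∃ c : ℤ → ℤ, StrictMono c ∧ (∀ v, c (v + r) = c v + n) ∧ Set.range c = D := by
  classical
  have hr' : (0 : ℤ) < r := by exact_mod_cast hr
  unfold windowCount at hcard
  set F := (Finset.Ioc (0 : ℤ) n).filter (· ∈ D)
  set f := F.orderEmbOfFin hcard
  have hf : ∀ i, (0 < f i ∧ f i ≤ n) ∧ f i ∈ D := fun i => by
    have h := Finset.mem_filter.1 (F.orderEmbOfFin_mem hcard i)
    exact ⟨Finset.mem_Ioc.1 h.1, h.2⟩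
  have hlt : ∀ v : ℤ, (v % r).toNat < r := fun v => by
    have := Int.emod_lt_of_pos v hr'
    have := Int.emod_nonneg v hr'.ne'
    omega
  refine ⟨fun v => f ⟨(v % r).toNat, hlt v⟩ + n * (v / r), fun v w hvw => ?_, fun v => ?_, ?_⟩
  · have hle := Int.ediv_le_ediv hr' hvw.le
    dsimp only
    rcases hle.lt_or_eq with h | h
    · have h1 := (hf ⟨(v % r).toNat, hlt v⟩).1.2
      have h2 := (hf ⟨(w % r).toNat, hlt w⟩).1.1
      nlinarith
    · have h1 := Int.emod_add_mul_ediv v r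
      have h2 := Int.emod_add_mul_ediv w r
      rw [← h] at h2 ⊢
      have h3 := Int.emod_nonneg v hr'.ne'
      have : f ⟨(v % r).toNat, hlt v⟩ < f ⟨(w % r).toNat, hlt w⟩ := by
        rw [f.lt_iff_lt, Fin.mk_lt_mk]
        omega
      linarith
  · dsimp only
    have h1 : (v + r) % r = v % r := Int.add_emod_right _ _
    have h2 : (v + r) / r = v / r + 1 := Int.add_ediv_of_dvd_right (dvd_refl _) |>.trans (by
      rw [Int.ediv_self hr'.ne'])
    simp only [h1, h2]
    ring
  · ext x
    constructor
    · rintro ⟨v, rfl⟩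
      exact (hD.add_mul _ _).2 (hf _).2
    · intro hx
      obtain ⟨q, h0, h1⟩ := exists_mul_add_mem_window hn x
      have hxF : x + n * q ∈ F := by
        simp only [F, Finset.mem_filter, Finset.mem_Ioc]
        exact ⟨⟨h0, h1⟩, (hD.add_mul x q).2 hx⟩
      obtain ⟨i, hi⟩ : ∃ i, f i = x + n * q := by
        have : x + n * q ∈ Set.range f := by
          rw [F.range_orderEmbOfFin hcard]
          exact hxF
        exact this
      have hi0 : ((i : ℕ) : ℤ) < r := by exact_mod_cast i.2
      refine ⟨(i : ℕ) + r * (-q), ?_⟩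
      have e1 : (((i : ℕ) : ℤ) + r * (-q)) % r = (i : ℕ) := by
        rw [Int.add_mul_emod_self_left, Int.emod_eq_of_lt (by omega) hi0]
      have e2 : (((i : ℕ) : ℤ) + r * (-q)) / r = -q := by
        rw [Int.add_mul_ediv_left _ _ hr'.ne', Int.ediv_eq_zero_of_lt (by omega) hi0, zero_add]
      simp only [e1, e2, Int.toNat_natCast, Fin.eta, hi]
      ring

/-- A set without free positions is described by the sequence of its gaps of length three. -/
lemma IsCyclicStable.exists_isGapSequence {n k r : ℕ} {S : Set ℤ} (hS : IsCyclicStable n k S)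
    (hn : n = 2 * k + r) (hr : 0 < r) (hfree : ∀ y, ¬ IsFreePosition S y) :
    ∃ c, IsGapSequence n r c ∧ gapSet c = S := by
  set D : Set ℤ := {x | x ∈ S ∧ x + 2 ∉ S}
  have hD : IsPeriodicSet n D := fun x => by
    simp only [D, Set.mem_ofPred_eq]
    rw [hS.periodic, add_right_comm, hS.periodic]
  have h3 : ∀ x ∈ D, x + 3 ∈ S := fun x hx => by
    by_contra h
    refine hfree (x + 2) ⟨?_, hx.2, ?_⟩
    · rw [show x + 2 - 1 = x + 1 by ring]
      exact hS.succ_notMem x hx.1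
    · rwa [show x + 2 + 1 = x + 3 by ring]
  have hcard : windowCount n D = r := by
    have hu : (Set.univ : Set ℤ) = S ∪ shiftSet (-1) S ∪ shiftSet (-2) D := by
      symm
      refine Set.eq_univ_of_forall fun x => ?_
      simp only [D, Set.mem_union, mem_shiftSet, Set.mem_ofPred_eq]
      by_contra! h
      obtain ⟨⟨h1, h2⟩, h4⟩ := h
      refine hfree (x - 1) ⟨fun h5 => h1 ?_, h2, by simpa using h1⟩
      have := h4 (by rwa [show x + -2 = x - 1 - 1 by ring])
      rwa [show x + -2 + 2 = x by ring] at this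
    have h := windowCount_univ n
    rw [hu, windowCount_union, windowCount_union, windowCount_shift hS.periodic,
      windowCount_shift hD, hS.count] at h
    · omega
    · refine Set.disjoint_left.2 fun x hx hx' => hS.succ_notMem (x + -1) hx' ?_
      simpa using hx
    · refine Set.disjoint_left.2 fun x hx hx' => ?_
      rcases hx with hx | hx
      · exact hx'.2 (by rwa [show x + -2 + 2 = x by ring])
      · refine hS.succ_notMem _ hx'.1 ?_
        rw [show x + -2 + 1 = x + -1 by ring]
        exact hx
  obtain ⟨c, hmono, hper, hrange⟩ := hD.exists_strictMono (by omega) hr hcard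
  have hcD : ∀ v, c v ∈ D := fun v => hrange ▸ Set.mem_range_self v
  have hbetween : ∀ v x, c v < x → x < c (v + 1) → x ∉ D := fun v x h1 h2 hx => by
    rw [← hrange] at hx
    obtain ⟨w, rfl⟩ := hx
    have := hmono.lt_iff_lt.1 h1
    have := hmono.lt_iff_lt.1 h2
    omega
  have hrun : ∀ v, ∀ i : ℕ, c v + 3 + 2 * i ≤ c (v + 1) + 1 → c v + 3 + 2 * i ∈ S := by
    intro v i
    induction i with
    | zero => intro _; simpa using h3 _ (hcD v)
    | succ i ih =>
      intro hi
      push_cast at hi ⊢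
      have h4 := ih (by omega)
      by_contra h5
      refine hbetween v (c v + 3 + 2 * i) (by omega) (by omega) ⟨h4, ?_⟩
      rwa [show c v + 3 + 2 * (i : ℤ) + 2 = c v + 3 + 2 * (i + 1) by ring]
  have hrun' : ∀ v x, c v + 3 ≤ x → x ≤ c (v + 1) + 1 → (x - c v) % 2 = 1 → x ∈ S := by
    intro v x h1 h2 h4
    have h5 : x = c v + 3 + 2 * ((x - c v - 3) / 2).toNat := by omega
    rw [h5]
    exact hrun v _ (by omega)
  have hge : ∀ v, c v + 3 ≤ c (v + 1) := fun v => by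
    have h1 : c v < c (v + 1) := hmono (by omega)
    have h2 : c (v + 1) ≠ c v + 1 := fun h => hS.succ_notMem _ (hcD v).1 (h ▸ (hcD (v + 1)).1)
    have h4 : c (v + 1) ≠ c v + 2 := fun h => (hcD v).2 (h ▸ (hcD (v + 1)).1)
    omega
  have hseq : IsGapSequence n r c := by
    refine ⟨hper, hge, fun v => ?_⟩
    by_contra h
    have := hge v
    exact hS.succ_notMem _ (hcD (v + 1)).1 (hrun' v _ (by omega) le_rfl (by omega))
  refine ⟨c, hseq, Set.Subset.antisymm ?_ ?_⟩
  · rintro x ⟨v, h1, h2, h4⟩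
    have := hseq.odd v
    exact hrun' v x h1 (by omega) (by omega)
  · intro x hx
    obtain ⟨v, h1, h2⟩ := hseq.exists_lt_le x
    have ho := hseq.odd v
    have n1 : x ≠ c v + 1 := fun h => hS.succ_notMem _ (hcD v).1 (h ▸ hx)
    have n2 : x ≠ c v + 2 := fun h => (hcD v).2 (h ▸ hx)
    refine ⟨v, by omega, h2, ?_⟩
    by_contra h
    exact hS.succ_notMem x hx (hrun' v _ (by omega) (by omega) (by omega))

lemma hasStableWalk_of_not_isFreePosition {n k r m : ℕ} {A B : Set ℤ} (hn : n = 2 * k + r)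
    (hk : k = r + m) (hr : 0 < r) (hA : IsCyclicStable n k A) (hB : IsCyclicStable n k B)
    (hA' : ∀ y, ¬ IsFreePosition A y) (hB' : ∀ y, ¬ IsFreePosition B y) :
    HasStableWalk n k m A B := by
  obtain ⟨c, hc, rfl⟩ := hA.exists_isGapSequence hn hr hA'
  obtain ⟨e, he, rfl⟩ := hB.exists_isGapSequence hn hr hB'
  obtain ⟨j, hj⟩ := hc.exists_reindex_close (m := m) (by omega) hr he
  have he' := he.reindex j
  have hp := hc.parity_sub he'
  rw [← IsGapSequence.gapSet_reindex e j]
  by_cases h : (c 0 - e (0 - j) - m) % 2 = 0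
  · left
    -- All displacements have the parity of m here, so the bound m + 1 improves to m.
    refine hc.stableWalk hn he' (fun v => ?_) fun v => ?_
    · have h1 := abs_le.1 (hj v)
      have h2 := hp v
      rw [abs_le]
      omega
    · have h2 := hp v
      omega
  · right
    refine hc.stableWalk hn he' (fun v => by exact_mod_cast hj v) fun v => ?_
    have h2 := hp v
    push_cast
    omega

/-! ### The case r = 0 and the induction -/

lemma IsCyclicStable.succ_mem_iff {k : ℕ} {A : Set ℤ} (hk : 0 < k)
    (hA : IsCyclicStable (2 * k) k A) (x : ℤ) : x + 1 ∈ A ↔ x ∉ A := by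
  refine ⟨fun h h' => hA.succ_notMem x h' h, fun hx => ?_⟩
  by_contra hx'
  have hp : IsPeriodicSet (2 * k) (A ∪ shiftSet 1 A) := fun z => by
    simp only [Set.mem_union, hA.periodic z, (hA.periodic.shift 1) z]
  have := windowCount_lt (x := x) (by omega) hp (fun _ => Iff.rfl)
    (Set.subset_univ _) (Set.mem_univ x) (by simp [hx, hx'])
  rw [windowCount_union hA.disjoint_shift_one, windowCount_shift hA.periodic, hA.count,
    windowCount_univ] at this
  omega

lemma eq_of_succ_mem_iff {A B : Set ℤ} (hA : ∀ x, x + 1 ∈ A ↔ x ∉ A)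
    (hB : ∀ x, x + 1 ∈ B ↔ x ∉ B) (h : (0 : ℤ) ∈ A ↔ (0 : ℤ) ∈ B) : A = B := by
  ext x
  induction x using Int.induction_on with
  | zero => exact h
  | succ i ih => rw [hA, hB, ih]
  | pred i ih =>
    have h1 := hA (-i - 1)
    have h2 := hB (-i - 1)
    rw [sub_add_cancel] at h1 h2
    tauto

/-- For n = 2k only the even and the odd integers remain, and they are disjoint. -/
lemma hasStableWalk_two_mul {k m : ℕ} {A B : Set ℤ} (hk : 0 < k)
    (hA : IsCyclicStable (2 * k) k A) (hB : IsCyclicStable (2 * k) k B) :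
    HasStableWalk (2 * k) k m A B := by
  have hA' := hA.succ_mem_iff hk
  have hB' := hB.succ_mem_iff hk
  by_cases h : (0 : ℤ) ∈ A ↔ (0 : ℤ) ∈ B
  · exact StableWalk.exists_eq_or_eq_succ (d := 0) hA (eq_of_succ_mem_iff hA' hB' h) (by omega)
  · refine StableWalk.exists_eq_or_eq_succ (d := 1) hA ⟨_, hA.shift 1, hA.disjoint_shift_one, ?_⟩
      (by omega)
    refine eq_of_succ_mem_iff (fun x => hA' (x + 1)) hB' ?_
    rw [mem_shiftSet, hA']
    tauto

theorem hasStableWalk {n k r m : ℕ} {A B : Set ℤ} (hn : n = 2 * k + r) (hk : k = r + m)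
    (hm : 3 ≤ m) (hA : IsCyclicStable n k A) (hB : IsCyclicStable n k B) :
    HasStableWalk n k m A B := by
  induction r generalizing n k A B with
  | zero =>
    obtain rfl : n = 2 * k := hn
    exact hasStableWalk_two_mul (by omega) hA hB
  | succ r ih =>
    by_cases hfA : ∀ y, ¬ IsFreePosition A y
    · by_cases hfB : ∀ y, ¬ IsFreePosition B y
      · exact hasStableWalk_of_not_isFreePosition hn hk (by omega) hA hB hfA hfB
      · push Not at hfB
        obtain ⟨z, hz⟩ := hfB
        obtain ⟨k, rfl⟩ : ∃ l, k = l + 1 := ⟨k - 1, by omega⟩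
        obtain ⟨n, rfl⟩ : ∃ l, n = l + 3 := ⟨n - 3, by omega⟩
        exact (hasStableWalk_of_isFreePosition_left (by omega) hm (by omega)
          (fun T U hT hU => ih (by omega) (by omega) hT hU) hB hA hz hfA).symm hB
    · push Not at hfA
      obtain ⟨y, hy⟩ := hfA
      obtain ⟨k, rfl⟩ : ∃ l, k = l + 1 := ⟨k - 1, by omega⟩
      obtain ⟨n, rfl⟩ : ∃ l, n = l + 3 := ⟨n - 3, by omega⟩
      by_cases hfB : ∀ y, ¬ IsFreePosition B y
      · exact hasStableWalk_of_isFreePosition_left (by omega) hm (by omega)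
          (fun T U hT hU => ih (by omega) (by omega) hT hU) hA hB hy hfB
      · push Not at hfB
        obtain ⟨z, hz⟩ := hfB
        exact hasStableWalk_of_isFreePosition_both (by omega) hm
          (fun T U hT hU => ih (by omega) (by omega) hT hU) hA hB hy hz

/-! ### Transfer to the Schrijver graph -/

lemma isCyclicStable_of_isStable {n k : ℕ} {A : Finset ℕ} (hn : 2 ≤ n)
    (hA : A ⊆ Finset.Icc 1 n) (hcard : A.card = k) (h : IsStable 2 n A) :
    IsCyclicStable n k (periodize n fun x => x.toNat ∈ A) where
  periodic := isPeriodicSet_periodize _ _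
  succ_notMem := by
    refine succ_notMem_of_window (by omega) (isPeriodicSet_periodize _ _) ?_ ?_
    · intro x h0 h1 hx hx'
      rw [mem_periodize (by omega) (by omega)] at hx hx'
      have h2 := (h _ hx _ hx' (by omega)).1
      rw [le_abs] at h2
      omega
    · intro hx hx'
      rw [mem_periodize (by omega) (by omega)] at hx hx'
      have h2 := (h _ hx _ hx' (by omega)).2
      rw [abs_le] at h2
      omega
  count := by
    classical
    rw [← hcard, ← Finset.card_map (Nat.castEmbedding (R := ℤ))]
    unfold windowCount
    congr 1
    ext x
    simp only [Finset.mem_filter, Finset.mem_Ioc, Finset.mem_map, Nat.castEmbedding_apply]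
    constructor
    · rintro ⟨⟨h0, h1⟩, hx⟩
      rw [mem_periodize h0 h1] at hx
      exact ⟨_, hx, by omega⟩
    · rintro ⟨a, ha, rfl⟩
      have := Finset.mem_Icc.1 (hA ha)
      exact ⟨by omega, (mem_periodize (by omega) (by omega)).2 (by simpa using ha)⟩

/-- The elements of `S` in the window `1, …, n`, as natural numbers. -/
noncomputable def windowFinset (n : ℕ) (S : Set ℤ) : Finset ℕ :=
  open Classical in (Finset.Icc 1 n).filter fun i => (i : ℤ) ∈ S

lemma mem_windowFinset {n i : ℕ} {S : Set ℤ} :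
    i ∈ windowFinset n S ↔ (1 ≤ i ∧ i ≤ n) ∧ (i : ℤ) ∈ S := by
  simp [windowFinset]

lemma card_windowFinset (n : ℕ) (S : Set ℤ) : (windowFinset n S).card = windowCount n S := by
  classical
  rw [← Finset.card_map (Nat.castEmbedding (R := ℤ))]
  unfold windowCount
  congr 1
  ext x
  simp only [Finset.mem_filter, Finset.mem_Ioc, Finset.mem_map, Nat.castEmbedding_apply,
    mem_windowFinset]
  constructor
  · rintro ⟨a, ⟨ha, haS⟩, rfl⟩
    exact ⟨by omega, haS⟩
  · rintro ⟨h, hx⟩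
    exact ⟨x.toNat, ⟨by omega, by rwa [Int.toNat_of_nonneg (by omega)]⟩, by omega⟩

lemma IsCyclicStable.isStable_windowFinset {n k : ℕ} {S : Set ℤ} (hS : IsCyclicStable n k S) :
    IsStable 2 n (windowFinset n S) := by
  have key : ∀ i ∈ windowFinset n S, ∀ j ∈ windowFinset n S, i < j →
      (2 : ℤ) ≤ j - i ∧ (j : ℤ) - i ≤ n - 2 := by
    intro i hi j hj hij
    rw [mem_windowFinset] at hi hj
    have h1 : (j : ℤ) ≠ i + 1 := fun h => hS.succ_notMem _ hi.2 (h ▸ hj.2)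
    have h2 : ¬ (i = 1 ∧ j = n) := by
      rintro ⟨rfl, rfl⟩
      exact hS.one_notMem hj.2 (by exact_mod_cast hi.2)
    omega
  intro i hi j hj hij
  rcases lt_or_gt_of_ne hij with h | h
  · have := key i hi j hj h
    rw [abs_sub_comm, abs_of_nonneg (by omega)]
    exact_mod_cast this
  · have := key j hj i hi h
    rw [abs_of_nonneg (by omega)]
    exact_mod_cast this

/-- The vertex of the Schrijver graph given by a cyclically stable set. -/
noncomputable def schrijverVertex {n k : ℕ} {S : Set ℤ} (hS : IsCyclicStable n k S) :
    stableVertices 2 n k :=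
  ⟨⟨windowFinset n S, fun _ hi => Finset.mem_Icc.2 (mem_windowFinset.1 hi).1,
    (card_windowFinset n S).trans hS.count⟩, hS.isStable_windowFinset⟩

lemma exists_schrijverVertex_eq {n k : ℕ} (hn : 2 ≤ n) (v : stableVertices 2 n k) :
    ∃ (S : Set ℤ) (hS : IsCyclicStable n k S), schrijverVertex hS = v := by
  obtain ⟨⟨A, hA, hcard⟩, hv⟩ := v
  refine ⟨_, isCyclicStable_of_isStable hn hA hcard hv, ?_⟩
  apply Subtype.ext
  apply Subtype.ext
  ext i
  simp only [schrijverVertex, mem_windowFinset]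
  constructor
  · rintro ⟨⟨h0, h1⟩, hi⟩
    rw [mem_periodize (by omega) (by omega)] at hi
    simpa using hi
  · intro hi
    have := Finset.mem_Icc.1 (hA hi)
    exact ⟨this, (mem_periodize (by omega) (by omega)).2 (by simpa using hi)⟩

lemma schrijverGraph_adj {n k : ℕ} {S T : Set ℤ} (hk : 0 < k) (hS : IsCyclicStable n k S)
    (hT : IsCyclicStable n k T) (h : Disjoint S T) :
    (schrijverGraph n k).Adj (schrijverVertex hS) (schrijverVertex hT) := by
  have hd : Disjoint (windowFinset n S) (windowFinset n T) :=
    Finset.disjoint_left.2 fun i hi hi' =>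
      Set.disjoint_left.1 h (mem_windowFinset.1 hi).2 (mem_windowFinset.1 hi').2
  refine ⟨fun he => ?_, hd⟩
  have he' : windowFinset n S = windowFinset n T := congrArg Subtype.val he
  rw [he', disjoint_self, Finset.bot_eq_empty] at hd
  have := card_windowFinset n T
  rw [hd, hT.count, Finset.card_empty] at this
  omega

lemma StableWalk.exists_walk {n k d : ℕ} {S T : Set ℤ} (hk : 0 < k) (hS : IsCyclicStable n k S)
    (hT : IsCyclicStable n k T) (h : StableWalk n k d S T) :
    ∃ p : (schrijverGraph n k).Walk (schrijverVertex hS) (schrijverVertex hT), p.length = d := by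
  induction d generalizing S with
  | zero =>
    obtain rfl : S = T := h
    exact ⟨.nil, rfl⟩
  | succ d ih =>
    obtain ⟨C, hC, hSC, hCT⟩ := h
    obtain ⟨p, hp⟩ := ih hC hCT
    exact ⟨.cons (schrijverGraph_adj hk hS hC hSC) p, by simp [hp]⟩

lemma stableVertices_nonempty (k r : ℕ) (hr : 0 < r) :
    Nonempty (stableVertices 2 (2 * k + r) k) := by
  refine ⟨⟨⟨(Finset.range k).image fun i => 2 * i + 1, ?_, ?_⟩, ?_⟩⟩
  · intro x hx
    simp only [Finset.mem_image, Finset.mem_range] at hx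
    obtain ⟨i, hi, rfl⟩ := hx
    exact Finset.mem_Icc.2 ⟨by omega, by omega⟩
  · rw [Finset.card_image_of_injective _ fun a b h => by simpa using h, Finset.card_range]
  · intro x hx y hy hxy
    simp only [Finset.mem_image, Finset.mem_range] at hx hy
    obtain ⟨i, hi, rfl⟩ := hx
    obtain ⟨j, hj, rfl⟩ := hy
    rw [le_abs, abs_le]
    omega

theorem schrijverGraph_connected_and_diam_le {k r m : ℕ} (hk : k = r + m) (hr : 0 < r)
    (hm : 3 ≤ m) :
    (schrijverGraph (2 * k + r) k).Connected ∧ (schrijverGraph (2 * k + r) k).diam ≤ m + 1 := by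
  have hne := stableVertices_nonempty k r hr
  have key : ∀ u v, ∃ p : (schrijverGraph (2 * k + r) k).Walk u v, p.length ≤ m + 1 := by
    intro u v
    obtain ⟨S, hS, rfl⟩ := exists_schrijverVertex_eq (by omega) u
    obtain ⟨T, hT, rfl⟩ := exists_schrijverVertex_eq (by omega) v
    rcases hasStableWalk rfl hk hm hS hT with h | h
    · obtain ⟨p, hp⟩ := h.exists_walk (by omega) hS hT
      exact ⟨p, by omega⟩
    · obtain ⟨p, hp⟩ := h.exists_walk (by omega) hS hT
      exact ⟨p, by omega⟩
  refine ⟨⟨fun u v => (key u v).choose.reachable⟩, ?_⟩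
  obtain ⟨u, v, huv⟩ := (schrijverGraph (2 * k + r) k).exists_dist_eq_diam
  obtain ⟨p, hp⟩ := key u v
  rw [← huv]
  exact (SimpleGraph.dist_le p).trans hp

/-- Upper bound for the diameter of Schrijver graphs. Connectedness is stated explicitly since
the natural-number valued `SimpleGraph.diam` is `0` on disconnected graphs. -/
theorem mainTheorem3 :
    (∀ n k m : ℕ, (n : ℤ) = 3 * (k : ℤ) - 2 - (m : ℤ) → 1 ≤ m → (m : ℤ) ≤ (k : ℤ) - 4 →
      (schrijverGraph n k).Connected ∧ (schrijverGraph n k).diam ≤ m + 3) ∧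
    (∀ k r : ℕ, 2 ≤ r → (r : ℤ) ≤ (k : ℤ) - 3 →
      (schrijverGraph (2 * k + r) k).Connected ∧
        ((schrijverGraph (2 * k + r) k).diam : ℤ) ≤ (k : ℤ) - (r : ℤ) + 1) := by
  constructor
  · intro n k m hn hm hmk
    obtain rfl : n = 2 * k + (k - (m + 2)) := by omega
    exact schrijverGraph_connected_and_diam_le (m := m + 2) (by omega) (by omega) (by omega)
  · intro k r hr hrk
    obtain ⟨h1, h2⟩ := schrijverGraph_connected_and_diam_le (k := k) (r := r) (m := k - r)
      (by omega) (by omega) (by omega)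
    exact ⟨h1, by omega⟩
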